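/- Let $F$ be an algebraic function field in one variable over a finite field $\mathbb{F}_q$ of characteristic $p$, of genus $g$. Let $P_1,\dots,P_n$ ($n\ge 1$) be pairwise distinct rational places of $F$, put $D=P_1+\cdots+P_n$, and let $G$ be a divisor of $F$ whose support is disjoint from that of $D$. Write $\mathrm{ev}_D(f)=(f(P_1),\dots,f(P_n))$ and $C_L(D,G)=\{\mathrm{ev}_D(f)\mid f\in L(G)\}\subseteq\mathbb{F}_q^n$. Let $1\le s\le \ell$ and $e\ge 0$ be integers. Given a divisor $A$ with support disjoint from that of $D$, the inseparable Guruswami--Sudan list-decoder with exponent $e$, multiplicity parameter $s$ and designed list size $\ell$ works as follows. For a received word $r=(r_1,\dots,r_n)\in\mathbb{F}_q^n$ it computes some nonzero polynomial $Q(z)=\sum_{j=0}^{\ell}Q_jz^{p^ej}\in F[z]$ with $Q_j\in L(A-p^ejG)$ for $j=0,\dots,\ell$ that has a zero of multiplicity at least $p^es$ at $(P_i,r_i)$ for $i=1,\dots,n$, and it returns the codewords $\mathrm{ev}_D(f)$ of all roots $f\in L(G)$ of $Q$; if no such $Q$ exists, it returns the empty list. Here $Q$ has a zero of multiplicity at least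 $m$ at $(P,r)$ if, for a local parameter $\phi$ of $P$, one can write $Q(z)=\sum_{a,b\ge 0}c_{a,b}\phi^a(z-r)^b$ with $c_{a,b}\in\mathbb{F}_q$ and $c_{a,b}=0$ whenever $a+b<m$. The decoder is said to have list-decoding radius at least $\rho\in\mathbb{R}$ if for every integer $\tau$ with $0\le\tau\le\rho$ there is a divisor $A$ with support disjoint from that of $D$ and $\deg A=p^es(n-\tau)-1$, and for every such $A$, every choice of the polynomials $Q$ and every received word $r$, the returned list has at most $\ell$ elements and contains all codewords of $C_L(D,G)$ at Hamming distance at most $\tau$ from $r$. Then the inseparable Guruswami--Sudan list-decoder with exponent $e$ has list-decoding radius at least $$\frac{s(2\ell-s+1)n-\ell(\ell+1)\deg G}{2s(\ell+1)}-\frac{1+g\ell}{p^e s(\ell+1)}.$$ In particular, for $e=\lceil\log_p(1+g\ell)\rceil$ it has list-decoding radius at least $$\frac{s(2\ell-s+1)n-\ell(\ell+1)\deg G-2}{2s(\ell+1)}.$$ -/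

import Mathlib

open Polynomial
open scoped WithZero

noncomputable section

namespace AGCode

/-- A place of the function field `F / K`, given by its valuation ring `𝒪_P`: a discrete valuation
ring with quotient field `F` that contains the constants `K`. The place itself is the maximal ideal
of this ring. -/
structure Place (K F : Type*) [Field K] [Field F] [Algebra K F] where
  /-- the valuation ring `𝒪_P` -/
  ring : ValuationSubring F
  algebraMap_mem : ∀ c : K, algebraMap K F c ∈ ring
  isDVR : IsDiscreteValuationRing ring

variable {K F : Type*} [Field K] [Field F] [Algebra K F]

namespace Place

instance (P : Place K F) : IsDiscreteValuationRing P.ring := P.isDVR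

instance (P : Place K F) : Algebra K P.ring :=
  ((algebraMap K F).codRestrict P.ring.toSubring P.algebraMap_mem).toAlgebra

/-- The residue field `F_P = 𝒪_P / P`, a `K`-algebra. -/
abbrev Residue (P : Place K F) : Type _ := IsLocalRing.ResidueField P.ring

/-- The degree of a place, `[F_P : K]`. -/
def degree (P : Place K F) : ℕ := Module.finrank K P.Residue

/-- A place is rational if it has degree one. -/
def IsRational (P : Place K F) : Prop := P.degree = 1

/-- The normalized discrete valuation of `P`, written multiplicatively. -/
def val (P : Place K F) : Valuation F ℤᵐ⁰ :=
  (IsDiscreteValuationRing.maximalIdeal P.ring).valuation F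

/-- The normalized discrete valuation `v_P(f) ∈ ℤ` for `f ≠ 0` (with the junk value `0` at `0`). -/
def ord (P : Place K F) (f : F) : ℤ := -WithZero.log (P.val f)

/-- The value `f(P) ∈ K` of `f ∈ 𝒪_P` at a rational place `P`: the residue class of `f` in `F_P`,
where `F_P` is identified with `K` through the structure map `K → F_P`, which is bijective
for rational `P`. (Junk value `0` if `f` has a pole at `P`.) -/
def eval (P : Place K F) (f : F) : K :=
  open Classical in
  if h : f ∈ P.ring then
    Function.invFun (algebraMap K P.Residue) (IsLocalRing.residue P.ring ⟨f, h⟩)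
  else 0

/-- `h = ∑_{a ≥ 0} c_a φ ^ a`, as a series that converges with respect to `P`: the `N`-th remainder
is zero or has valuation at least `N`, for all `N`. -/
def HasExpansion (P : Place K F) (φ h : F) (c : ℕ → K) : Prop :=
  ∀ N : ℕ, h - ∑ a ∈ Finset.range N, algebraMap K F (c a) * φ ^ a = 0 ∨
    (N : ℤ) ≤ P.ord (h - ∑ a ∈ Finset.range N, algebraMap K F (c a) * φ ^ a)

/-- `Q(z)` has `(P, r)` as a zero of multiplicity at least `m`: for a local parameter `φ` of `P`,
`Q(z) = ∑_{a, b ≥ 0} c_{a,b} φ ^ a (z - r) ^ b` with `c_{a,b} ∈ K` and `c_{a,b} = 0` whenever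
`a + b < m`. (The coefficient of `(z - r) ^ b` in `Q` is the `b`-th coefficient of the Taylor
expansion of `Q` at `r`.) -/
def HasZeroOfMultAtLeast (P : Place K F) (r : K) (m : ℕ) (Q : F[X]) : Prop :=
  ∃ φ : F, P.ord φ = 1 ∧ ∃ c : ℕ → ℕ → K,
    (∀ b : ℕ, P.HasExpansion φ ((taylor (algebraMap K F r) Q).coeff b) (fun a => c a b)) ∧
    ∀ a b : ℕ, a + b < m → c a b = 0

theorem zero_or_ord_iff (P : Place K F) (f : F) (m : ℤ) :
    (f = 0 ∨ 0 ≤ P.ord f + m) ↔ P.val f ≤ WithZero.exp m := by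
  by_cases hf : f = 0
  · simp [hf]
  · have hv : P.val f ≠ 0 := (Valuation.ne_zero_iff _).2 hf
    rw [← WithZero.log_le_iff_le_exp hv, ord]
    constructor
    · rintro (h | h)
      · exact absurd h hf
      · linarith
    · intro h
      right
      linarith

theorem val_algebraMap_le_one (P : Place K F) (c : K) : P.val (algebraMap K F c) ≤ 1 :=
  (IsDiscreteValuationRing.maximalIdeal P.ring).valuation_le_one (K := F)
    ⟨algebraMap K F c, P.algebraMap_mem c⟩

end Place

/-- Divisors of `F / K`: formal integral sums of places. -/
abbrev Divisor (K F : Type*) [Field K] [Field F] [Algebra K F] : Type _ := Place K F →₀ ℤ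

/-- The degree `∑_P v_P(A) deg P` of a divisor. -/
def Divisor.deg (A : Divisor K F) : ℤ := A.sum fun P m => m * (P.degree : ℤ)

/-- The Riemann-Roch space `L(A) = {f ≠ 0 | (f) + A ≥ 0} ∪ {0}`. -/
def Divisor.L (A : Divisor K F) : Submodule K F where
  carrier := {f | f = 0 ∨ ∀ P : Place K F, 0 ≤ P.ord f + A P}
  zero_mem' := Or.inl rfl
  add_mem' := by
    intro f g hf hg
    simp only [Set.mem_ofPred_eq, or_iff_not_imp_left] at *
    intro hfg P
    refine ((P.zero_or_ord_iff (f + g) (A P)).2 ?_).resolve_left hfg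
    refine (Valuation.map_add _ _ _).trans (max_le ?_ ?_)
    · exact (P.zero_or_ord_iff f (A P)).1 (or_iff_not_imp_left.2 fun h => hf h P)
    · exact (P.zero_or_ord_iff g (A P)).1 (or_iff_not_imp_left.2 fun h => hg h P)
  smul_mem' := by
    intro c f hf
    simp only [Set.mem_ofPred_eq, or_iff_not_imp_left] at *
    intro hcf P
    refine ((P.zero_or_ord_iff (c • f) (A P)).2 ?_).resolve_left hcf
    rw [Algebra.smul_def, map_mul]
    have h := (P.zero_or_ord_iff f (A P)).1 (or_iff_not_imp_left.2 fun h => hf h P)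
    exact (mul_le_mul' (P.val_algebraMap_le_one c) h).trans (one_mul _).le

/-- The dimension of `L(A)` over `K`. -/
def Divisor.dim (A : Divisor K F) : ℕ := Module.finrank K A.L

/-- The genus of `F / K`: the maximum of `deg A - dim L(A) + 1` over all divisors `A` (nonnegative,
as `A = 0` shows). -/
def genus (K F : Type*) [Field K] [Field F] [Algebra K F] : ℕ :=
  (⨆ A : Divisor K F, (A.deg - (A.dim : ℤ) + 1)).toNat

variable {n : ℕ}

/-- The evaluation map `ev_D(f) = (f(P_1), …, f(P_n))`. -/
def ev (P : Fin n → Place K F) (f : F) : Fin n → K := fun i => (P i).eval f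

/-- The support of `A` is disjoint from that of `D = P_1 + ⋯ + P_n`. -/
def SupportDisjoint (P : Fin n → Place K F) (A : Divisor K F) : Prop := ∀ i, A (P i) = 0

/-- The algebraic geometry code `C_L(D, G)`, `D = P_1 + ⋯ + P_n`. -/
def code (P : Fin n → Place K F) (G : Divisor K F) : Set (Fin n → K) := ev P '' (G.L : Set F)

/-- `Q(z)` is an interpolation polynomial for the received word `r`: it is nonzero, of the form
`Q_ℓ z ^ (p ^ e * ℓ) + ⋯ + Q_1 z ^ (p ^ e) + Q_0` with `Q_j ∈ L(A - p ^ e j G)`, and has all points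
`(P_i, r_i)` as zeroes of multiplicity at least `p ^ e * s`. -/
def IsInterpolation (P : Fin n → Place K F) (G A : Divisor K F) (p s ℓ e : ℕ) (r : Fin n → K)
    (Q : F[X]) : Prop :=
  Q ≠ 0 ∧
  (∃ q : ℕ → F, (∀ j ≤ ℓ, q j ∈ (A - (p ^ e * j) • G).L) ∧
    Q = ∑ j ∈ Finset.range (ℓ + 1), C (q j) * X ^ (p ^ e * j)) ∧
  ∀ i, (P i).HasZeroOfMultAtLeast (r i) (p ^ e * s) Q

/-- `Dec` is an inseparable Guruswami-Sudan decoder for `C_L(D, G)` with exponent `e`, multiplicity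
parameter `s`, designed list size `ℓ` and auxiliary divisor `A`: for each received word `r` it
computes some interpolation polynomial `Q` and returns the codewords `ev_D(f)` of the roots
`f ∈ L(G)` of `Q`; it returns the empty list if there is no interpolation polynomial. -/
def IsInsepGSDecoder (P : Fin n → Place K F) (G A : Divisor K F) (p s ℓ e : ℕ)
    (Dec : (Fin n → K) → Set (Fin n → K)) : Prop :=
  ∀ r : Fin n → K,
    (∃ Q : F[X], IsInterpolation P G A p s ℓ e r Q ∧
      Dec r = ev P '' {f : F | f ∈ G.L ∧ Q.eval f = 0}) ∨
    ((¬ ∃ Q : F[X], IsInterpolation P G A p s ℓ e r Q) ∧ Dec r = ∅)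

/-- `Dec` is a list-decoder for the code `𝒞` that corrects `τ` errors with list size at most `ℓ`:
for each received word it returns at most `ℓ` codewords, among them all those at Hamming distance
at most `τ`. -/
def IsListDecoder [DecidableEq K] (𝒞 : Set (Fin n → K)) (ℓ τ : ℕ)
    (Dec : (Fin n → K) → Set (Fin n → K)) : Prop :=
  ∀ r : Fin n → K, Dec r ⊆ 𝒞 ∧ (Dec r).encard ≤ ℓ ∧
    ∀ c ∈ 𝒞, hammingDist r c ≤ τ → c ∈ Dec r

/-- The inseparable Guruswami-Sudan list-decoder for `C_L(D, G)` with parameters `s ≤ ℓ` and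
exponent `e` has list-decoding radius at least `ρ`: for each number `τ ≤ ρ` of errors there are
auxiliary divisors `A`, with support disjoint from `D`, of the largest degree with
`deg A < p ^ e s (n - τ)`, and each decoder that uses such an `A` corrects `τ` errors with list
size at most `ℓ`. -/
def InsepGSHasRadiusAtLeast [DecidableEq K] (P : Fin n → Place K F) (G : Divisor K F)
    (p s ℓ e : ℕ) (ρ : ℝ) : Prop :=
  ∀ τ : ℕ, (τ : ℝ) ≤ ρ →
    (∃ A : Divisor K F, SupportDisjoint P A ∧
      A.deg = (p : ℤ) ^ e * s * ((n : ℤ) - τ) - 1) ∧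
    ∀ A : Divisor K F, SupportDisjoint P A →
      A.deg = (p : ℤ) ^ e * s * ((n : ℤ) - τ) - 1 →
      ∀ Dec : (Fin n → K) → Set (Fin n → K), IsInsepGSDecoder P G A p s ℓ e Dec →
        IsListDecoder (code P G) ℓ τ Dec

end AGCode

end

noncomputable section

namespace AGCode

variable {K F : Type*} [Field K] [Field F] [Algebra K F]

/-! ### Orders and balls at a place. -/

namespace Place

/-! Write `q = p ^ e` and let `g` be the genus. If `f ∈ L(G)` agrees with `r` in at least `n - τ`
positions, then `Q(f)` lies in `L(A)` and vanishes to order `q s` at each of them. A nonzero value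
would force `deg A ≥ q s (n - τ)`, so `Q(f) = 0` (`IsInterpolation.eval_eq_zero`). As `Q` is a
polynomial of degree at most `ℓ` in `z ^ q` and Frobenius is injective, it has at most `ℓ` roots
(`encard_roots_insepPoly_le`).

It remains to find `Q` when some codeword `ev_D(f)` is within distance `τ` of `r`
(`exists_isInterpolation`); if there is none, an empty list is correct. Since `f` is available to
the argument, one looks for `Q(z) = R(z - f)` with `R = ∑_{j=1}^ℓ v_j z ^ (q j)`, without constant
term. In characteristic `p`, `(z + a) ^ (q j) = (z ^ q + a ^ q) ^ j`, so translation keeps this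
shape (`taylor_insepPoly`), and the multiplicity condition only asks that the coefficient of `z ^ (q
b)` have order at least `q (s - b)`. An error position costs `q s (s + 1) / 2` linear conditions. At
an error-free position `r_i - f` vanishes, so it is enough to constrain `v_1, …, v_{s-1}`, which
costs `q s (s - 1) / 2`. By Riemann's inequality the unknowns have dimension at least `ℓ (deg A + 1
- g) - q ℓ (ℓ + 1) deg G / 2`. Comparing the two counts gives the radius; the conditions scale with
`q` but the genus does not, which is why the correction term is divided by `p ^ e`.

The function field theory needed is `Divisor.riemann_inequality` and `Divisor.deg_princ`. Weak
approximation bounds the zeros of `x` by `[F : K(x)]` (`sum_ord_mul_card_le`); the growth of `L(k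
(x)_∞ + C)` in `k` turns this into an equality (`Divisor.deg_poles`) and also bounds `deg A - dim
L(A)`. Poles exist because a proper valuation ring containing `K` is discrete. -/

theorem ord_zero (P : Place K F) : P.ord 0 = 0 := by simp [ord]

theorem ord_one (P : Place K F) : P.ord 1 = 0 := by simp [ord]

theorem val_ne_zero (P : Place K F) {f : F} (hf : f ≠ 0) : P.val f ≠ 0 :=
  (Valuation.ne_zero_iff _).2 hf

theorem ord_mul (P : Place K F) {f g : F} (hf : f ≠ 0) (hg : g ≠ 0) :
    P.ord (f * g) = P.ord f + P.ord g := by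
  rw [ord, map_mul, WithZero.log_mul (P.val_ne_zero hf) (P.val_ne_zero hg), ord, ord]
  ring

theorem ord_inv (P : Place K F) (f : F) : P.ord f⁻¹ = -P.ord f := by
  rw [ord, map_inv₀, WithZero.log_inv, ord]

theorem ord_div (P : Place K F) {f g : F} (hf : f ≠ 0) (hg : g ≠ 0) :
    P.ord (f / g) = P.ord f - P.ord g := by
  rw [div_eq_mul_inv, P.ord_mul hf (inv_ne_zero hg), ord_inv, sub_eq_add_neg]

theorem ord_pow (P : Place K F) (f : F) (m : ℕ) : P.ord (f ^ m) = m * P.ord f := by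
  rw [ord, map_pow, WithZero.log_pow, ord, nsmul_eq_mul]
  ring

theorem ord_zpow (P : Place K F) (f : F) (m : ℤ) : P.ord (f ^ m) = m * P.ord f := by
  rw [ord, map_zpow₀, WithZero.log_zpow, ord, smul_eq_mul]
  ring

/-- The elements of valuation at least `k` at `P`. -/
def ball (P : Place K F) (k : ℤ) : Submodule K F where
  carrier := {f | P.val f ≤ WithZero.exp (-k)}
  zero_mem' := by simp
  add_mem' hf hg := by
    simp only [Set.mem_ofPred_eq] at *
    exact (Valuation.map_add _ _ _).trans (max_le hf hg)
  smul_mem' c f hf := by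
    simp only [Set.mem_ofPred_eq] at *
    rw [Algebra.smul_def, map_mul]
    exact (mul_le_mul' (P.val_algebraMap_le_one c) hf).trans (one_mul _).le

theorem mem_ball_iff_val (P : Place K F) {k : ℤ} {f : F} :
    f ∈ P.ball k ↔ P.val f ≤ WithZero.exp (-k) := Set.mem_ofPred

theorem mem_ball (P : Place K F) {k : ℤ} {f : F} : f ∈ P.ball k ↔ f = 0 ∨ k ≤ P.ord f := by
  rw [mem_ball_iff_val, ← zero_or_ord_iff]
  refine or_congr_right ⟨fun h => by linarith, fun h => by linarith⟩

theorem mem_ball_of_ne (P : Place K F) {k : ℤ} {f : F} (hf : f ≠ 0) :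
    f ∈ P.ball k ↔ k ≤ P.ord f := by
  rw [mem_ball, or_iff_right hf]

theorem ball_anti (P : Place K F) {k m : ℤ} (h : k ≤ m) : P.ball m ≤ P.ball k := by
  intro f hf
  rw [mem_ball] at *
  exact hf.imp_right h.trans

theorem mul_mem_ball (P : Place K F) {k m : ℤ} {f g : F} (hf : f ∈ P.ball k) (hg : g ∈ P.ball m) :
    f * g ∈ P.ball (k + m) := by
  rw [mem_ball_iff_val] at *
  rw [map_mul, neg_add, WithZero.exp_add]
  exact mul_le_mul' hf hg

theorem algebraMap_mem_ball (P : Place K F) (c : K) : algebraMap K F c ∈ P.ball 0 := by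
  rw [mem_ball_iff_val]
  simpa using P.val_algebraMap_le_one c

theorem one_mem_ball (P : Place K F) : (1 : F) ∈ P.ball 0 := by
  simpa using P.algebraMap_mem_ball 1

theorem pow_mem_ball (P : Place K F) {k : ℤ} {f : F} (hf : f ∈ P.ball k) (m : ℕ) :
    f ^ m ∈ P.ball (m * k) := by
  induction m with
  | zero => simpa using P.one_mem_ball
  | succ m ih =>
    have := P.mul_mem_ball ih hf
    rwa [← pow_succ, show (m : ℤ) * k + k = ((m + 1 : ℕ) : ℤ) * k by push_cast; ring] at this

theorem mem_ring_iff (P : Place K F) {f : F} : f ∈ P.ring ↔ f ∈ P.ball 0 := by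
  rw [mem_ball_iff_val]
  constructor
  · intro h
    simpa [val] using
      (IsDiscreteValuationRing.maximalIdeal P.ring).valuation_le_one (K := F) ⟨f, h⟩
  · intro h
    obtain ⟨a, rfl⟩ := IsDiscreteValuationRing.exists_lift_of_le_one (A := P.ring) (K := F)
      (x := f) (by simpa [val] using h)
    exact a.2

theorem mem_ball_one_iff (P : Place K F) (f : P.ring) :
    (f : F) ∈ P.ball 1 ↔ f ∈ IsLocalRing.maximalIdeal P.ring := by
  have h := (IsDiscreteValuationRing.maximalIdeal P.ring).valuation_lt_one_iff_mem (K := F) f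
  change _ ↔ f ∈ (IsDiscreteValuationRing.maximalIdeal P.ring).asIdeal
  rw [← h, mem_ball_iff_val]
  change P.val f ≤ _ ↔ P.val f < 1
  by_cases hf : P.val f = 0
  · simp [hf]
  · rw [← WithZero.log_le_iff_le_exp hf, ← WithZero.log_lt_log hf one_ne_zero, WithZero.log_one]
    exact ⟨fun h => by linarith, fun h => by linarith⟩

theorem exists_ord_eq_one (P : Place K F) : ∃ t : F, P.ord t = 1 := by
  obtain ⟨t, ht⟩ :=
    (IsDiscreteValuationRing.maximalIdeal P.ring).valuation_exists_uniformizer F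
  refine ⟨t, ?_⟩
  rw [ord, val, ht]
  simp

theorem ne_zero_of_ord_ne_zero (P : Place K F) {f : F} (h : P.ord f ≠ 0) : f ≠ 0 := by
  rintro rfl
  exact h P.ord_zero

theorem le_ord_add (P : Place K F) {f g : F} {k : ℤ} (hfg : f + g ≠ 0)
    (hf : k ≤ P.ord f) (hg : k ≤ P.ord g) : k ≤ P.ord (f + g) :=
  (P.mem_ball_of_ne hfg).1 (add_mem (P.mem_ball.2 (Or.inr hf)) (P.mem_ball.2 (Or.inr hg)))

theorem add_ne_zero_of_ord_lt (P : Place K F) {f g : F} (h : P.ord f < P.ord g) :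
    f + g ≠ 0 := by
  intro h0
  rw [eq_neg_of_add_eq_zero_left h0, ord, Valuation.map_neg, ← ord] at h
  exact lt_irrefl _ h

theorem ord_add_of_lt (P : Place K F) {f g : F} (hf : f ≠ 0) (h : P.ord f < P.ord g) :
    P.ord (f + g) = P.ord f := by
  have hfg := P.add_ne_zero_of_ord_lt h
  refine le_antisymm ?_ (P.le_ord_add hfg le_rfl h.le)
  by_contra hlt
  push Not at hlt
  have hm : f + g - g ∈ P.ball (P.ord f + 1) :=
    sub_mem ((P.mem_ball_of_ne hfg).2 hlt) (P.mem_ball.2 (Or.inr h))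
  rw [add_sub_cancel_right, P.mem_ball_of_ne hf] at hm
  linarith

/-- The residue map of `P` as a `K`-linear map. -/
def residueMap (P : Place K F) : P.ball 0 →ₗ[K] P.Residue where
  toFun f := IsLocalRing.residue P.ring ⟨f, P.mem_ring_iff.2 f.2⟩
  map_add' f g := by
    rw [← map_add]
    rfl
  map_smul' c f := by
    have h : (⟨((c • f : P.ball 0) : F), P.mem_ring_iff.2 (c • f).2⟩ : P.ring) =
        algebraMap K P.ring c * ⟨f, P.mem_ring_iff.2 f.2⟩ := by
      apply Subtype.ext
      change c • (f : F) = algebraMap K F c * f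
      rw [Algebra.smul_def]
    rw [h, map_mul, RingHom.id_apply, Algebra.smul_def]
    rfl

theorem residueMap_eq_zero_iff (P : Place K F) (f : P.ball 0) :
    P.residueMap f = 0 ↔ (f : F) ∈ P.ball 1 := by
  rw [P.mem_ball_one_iff ⟨f, P.mem_ring_iff.2 f.2⟩]
  exact IsLocalRing.residue_eq_zero_iff _

theorem residueMap_surjective (P : Place K F) : Function.Surjective P.residueMap := by
  intro a
  obtain ⟨f, rfl⟩ := IsLocalRing.residue_surjective a
  exact ⟨⟨f, P.mem_ring_iff.1 f.2⟩, rfl⟩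

/-! ### Distinct places and weak approximation. -/

theorem ext_ring {P Q : Place K F} (h : P.ring = Q.ring) : P = Q := by
  cases P
  cases Q
  cases h
  rfl

theorem ring_ne_top (P : Place K F) : P.ring ≠ ⊤ := by
  intro h
  obtain ⟨t, ht⟩ := P.exists_ord_eq_one
  have : t⁻¹ ∈ P.ring := h ▸ ValuationSubring.mem_top _
  rw [mem_ring_iff, P.mem_ball_of_ne (inv_ne_zero (P.ne_zero_of_ord_ne_zero (by omega))),
    ord_inv] at this
  omega

/-- A discrete valuation ring is maximal among proper subrings: for `y` of negative order, every `f`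
is an integral element times a high power of `y`. -/
theorem eq_of_ring_le {P Q : Place K F} (h : P.ring ≤ Q.ring) : P = Q := by
  refine ext_ring (le_antisymm h fun y hy => ?_)
  by_contra hyP
  refine Q.ring_ne_top (eq_top_iff.2 fun f _ => ?_)
  by_cases hf : f = 0
  · rw [hf]
    exact zero_mem _
  have hy0 : y ≠ 0 := by
    rintro rfl
    exact hyP (zero_mem _)
  rw [mem_ring_iff, P.mem_ball_of_ne hy0, not_le] at hyP
  obtain ⟨N, hN⟩ : ∃ N : ℕ, -P.ord f ≤ N := ⟨(-P.ord f).toNat, Int.self_le_toNat _⟩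
  have hmem : f * (y ^ N)⁻¹ ∈ P.ring := by
    have hyN : y ^ N ≠ 0 := pow_ne_zero _ hy0
    rw [mem_ring_iff, P.mem_ball_of_ne (mul_ne_zero hf (inv_ne_zero hyN)),
      P.ord_mul hf (inv_ne_zero hyN), ord_inv, ord_pow]
    nlinarith
  have := mul_mem (h hmem) (pow_mem hy N)
  rwa [mul_assoc, inv_mul_cancel₀ (pow_ne_zero _ hy0), mul_one] at this

theorem exists_ord_pos_neg {P Q : Place K F} (h : P ≠ Q) :
    ∃ f : F, 0 < P.ord f ∧ Q.ord f < 0 := by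
  have key : ∀ {P Q : Place K F}, P ≠ Q → ∃ f : F, f ≠ 0 ∧ 0 ≤ P.ord f ∧ Q.ord f < 0 := by
    intro P Q h
    have : ¬ P.ring ≤ Q.ring := fun hle => h (eq_of_ring_le hle)
    obtain ⟨f, hfP, hfQ⟩ := SetLike.not_le_iff_exists.1 this
    have hf : f ≠ 0 := by
      rintro rfl
      exact hfQ (zero_mem _)
    rw [mem_ring_iff, mem_ball_of_ne _ hf] at hfP hfQ
    exact ⟨f, hf, hfP, not_le.1 hfQ⟩
  obtain ⟨f, hf, hfP, hfQ⟩ := key h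
  obtain ⟨g, hg, hgQ, hgP⟩ := key h.symm
  refine ⟨f / g, ?_, ?_⟩ <;> rw [ord_div _ hf hg] <;> linarith

/-- For `P ∉ T` there is a function with a zero at `P` and poles at all places of `T`. -/
theorem exists_ord_pos_forall_neg (P : Place K F) (T : Finset (Place K F)) (h : P ∉ T) :
    ∃ f : F, f ≠ 0 ∧ 0 < P.ord f ∧ ∀ Q ∈ T, Q.ord f < 0 := by
  classical
  induction T using Finset.induction_on with
  | empty =>
    obtain ⟨t, ht⟩ := P.exists_ord_eq_one
    exact ⟨t, P.ne_zero_of_ord_ne_zero (by omega), by omega, by simp⟩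
  | insert Q T hQ ih =>
    rw [Finset.mem_insert, not_or] at h
    obtain ⟨y, hy, hyP, hyT⟩ := ih h.2
    obtain ⟨w, hwP, hwQ⟩ := exists_ord_pos_neg h.1
    have hw : w ≠ 0 := P.ne_zero_of_ord_ne_zero hwP.ne'
    -- With `r` this large, `w ^ r` and `y` have different orders wherever `w` has nonzero order, so
    -- no cancellation occurs in `y + w ^ r`.
    obtain ⟨r, hr⟩ : ∃ r : ℕ, ∀ R ∈ insert Q T, |R.ord y| < r := by
      refine ⟨∑ R ∈ insert Q T, (R.ord y).natAbs + 1, fun R hR => ?_⟩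
      have := Finset.single_le_sum (f := fun R : Place K F => (R.ord y).natAbs)
        (fun _ _ => Nat.zero_le _) hR
      rw [Int.abs_eq_natAbs]
      omega
    have hr0 : (0 : ℤ) < r := (abs_nonneg _).trans_lt (hr Q (Finset.mem_insert_self _ _))
    have hwr : w ^ r ≠ 0 := pow_ne_zero _ hw
    have hneg : ∀ R ∈ insert Q T, R.ord (w ^ r) < 0 ∨ R.ord y < 0 → R.ord (w ^ r) ≠ R.ord y →
        y + w ^ r ≠ 0 ∧ R.ord (y + w ^ r) < 0 := by
      intro R _ hlt hne
      rcases lt_or_gt_of_ne hne with h1 | h1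
      · rw [add_comm]
        refine ⟨R.add_ne_zero_of_ord_lt h1, ?_⟩
        rw [R.ord_add_of_lt hwr h1]
        omega
      · refine ⟨R.add_ne_zero_of_ord_lt h1, ?_⟩
        rw [R.ord_add_of_lt hy h1]
        omega
    have hall : ∀ R ∈ insert Q T, y + w ^ r ≠ 0 ∧ R.ord (y + w ^ r) < 0 := by
      intro R hR
      have hrR := hr R hR
      have hne : R.ord w ≠ 0 → R.ord (w ^ r) ≠ R.ord y := by
        intro hw0 heq
        rw [← heq, ord_pow, abs_mul, Nat.abs_cast] at hrR
        have : 1 ≤ |R.ord w| := Int.one_le_abs hw0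
        nlinarith
      rcases Finset.mem_insert.1 hR with rfl | hRT
      · refine hneg _ hR (Or.inl ?_) (hne hwQ.ne)
        rw [ord_pow]
        nlinarith
      · refine hneg R hR (Or.inr (hyT R hRT)) ?_
        by_cases hw0 : R.ord w = 0
        · rw [ord_pow, hw0, mul_zero]
          exact (hyT R hRT).ne'
        · exact hne hw0
    have h0 := (hall Q (Finset.mem_insert_self _ _)).1
    refine ⟨y + w ^ r, h0, ?_, fun R hR => (hall R hR).2⟩
    refine Int.lt_of_add_one_le (P.le_ord_add h0 (by omega) ?_)
    rw [ord_pow]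
    nlinarith

/-- For `P ∉ T` there are functions arbitrarily close to `1` at `P` and to `0` at the places
of `T`. -/
theorem exists_sub_one_mem_ball (P : Place K F) (T : Finset (Place K F)) (h : P ∉ T) (N : ℕ) :
    ∃ f : F, f - 1 ∈ P.ball N ∧ ∀ Q ∈ T, f ∈ Q.ball N := by
  rcases Nat.eq_zero_or_pos N with rfl | hN
  · exact ⟨1, by simp, fun Q _ => by simpa using Q.one_mem_ball⟩
  obtain ⟨z, hz, hzP, hzT⟩ := P.exists_ord_pos_forall_neg T h
  have hzN : z ^ N ≠ 0 := pow_ne_zero _ hz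
  have hN' : (0 : ℤ) < N := by exact_mod_cast hN
  have hP : P.ord (1 : F) < P.ord (z ^ N) := by
    rw [ord_one, ord_pow]
    positivity
  have h1 : 1 + z ^ N ≠ 0 := P.add_ne_zero_of_ord_lt hP
  -- This is close to `1` where `z` has a zero and close to `0` where `z` has a pole.
  refine ⟨(1 + z ^ N)⁻¹, ?_, fun Q hQ => ?_⟩
  · have : (1 + z ^ N)⁻¹ - 1 = -(z ^ N / (1 + z ^ N)) := by
      field_simp
      ring
    rw [this, neg_mem_iff, P.mem_ball_of_ne (div_ne_zero hzN h1), P.ord_div hzN h1,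
      P.ord_add_of_lt one_ne_zero hP, ord_one, ord_pow]
    nlinarith
  · have hQ' : Q.ord (z ^ N) < Q.ord (1 : F) := by
      rw [ord_one, ord_pow]
      nlinarith [hzT Q hQ]
    rw [Q.mem_ball_of_ne (inv_ne_zero h1), ord_inv, add_comm, Q.ord_add_of_lt hzN hQ', ord_pow]
    nlinarith [hzT Q hQ]

/-- Weak approximation. -/
theorem weak_approximation (T : Finset (Place K F)) (y : Place K F → F) (N : ℤ) :
    ∃ z : F, ∀ P ∈ T, z - y P ∈ P.ball N := by
  classical
  obtain ⟨M, hM⟩ : ∃ M : ℕ, ∀ P ∈ T, ∀ Q ∈ T, N - P.ord (y Q) ≤ M := by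
    refine ⟨∑ P ∈ T, ∑ Q ∈ T, (N - P.ord (y Q)).natAbs, fun P hP Q hQ => ?_⟩
    have h1 := Finset.single_le_sum (f := fun R : Place K F => (N - P.ord (y R)).natAbs)
      (fun _ _ => Nat.zero_le _) hQ
    have h2 := Finset.single_le_sum
      (f := fun R : Place K F => ∑ Q ∈ T, (N - R.ord (y Q)).natAbs)
      (fun _ _ => Nat.zero_le _) hP
    omega
  choose e he using fun P : Place K F =>
    P.exists_sub_one_mem_ball (T.erase P) (Finset.notMem_erase _ _) M
  have hmul : ∀ P ∈ T, ∀ Q ∈ T, ∀ f ∈ P.ball M, f * y Q ∈ P.ball N := by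
    intro P hP Q hQ f hf
    have hy : y Q ∈ P.ball (P.ord (y Q)) := P.mem_ball.2 (Or.inr le_rfl)
    exact P.ball_anti (by linarith [hM P hP Q hQ]) (P.mul_mem_ball hf hy)
  refine ⟨∑ Q ∈ T, e Q * y Q, fun P hP => ?_⟩
  rw [← Finset.add_sum_erase _ _ hP,
    -- The identity does not involve `d`; the goal left for it is closed with the arbitrary value
    -- `0`.
    show ∀ a b c d : F, a * b + c - b = (a - 1) * b + c by intros; ring]
  · refine add_mem (hmul P hP P hP _ (he P).1) (sum_mem fun Q hQ => ?_)
    rw [Finset.mem_erase] at hQ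
    exact hmul P hP Q hQ.2 _ ((he Q).2 P (Finset.mem_erase.2 ⟨hQ.1.symm, hP⟩))
  · exact 0

/-- There are functions with prescribed orders at finitely many places. -/
theorem exists_forall_ord_eq (T : Finset (Place K F)) (k : Place K F → ℤ) :
    ∃ z : F, ∀ P ∈ T, P.ord z = k P := by
  choose t ht using fun P : Place K F => P.exists_ord_eq_one
  obtain ⟨N, hN⟩ : ∃ N : ℤ, ∀ P ∈ T, k P < N := by
    refine ⟨∑ P ∈ T, (k P).natAbs + 1, fun P hP => ?_⟩
    have := Finset.single_le_sum (f := fun P : Place K F => (k P).natAbs)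
      (fun _ _ => Nat.zero_le _) hP
    zify at this
    zify
    have := le_abs_self (k P)
    omega
  obtain ⟨z, hz⟩ := weak_approximation T (fun P => t P ^ k P) N
  refine ⟨z, fun P hP => ?_⟩
  have hord : P.ord (t P ^ k P) = k P := by rw [ord_zpow, ht, mul_one]
  have h0 : t P ^ k P ≠ 0 := zpow_ne_zero _ (P.ne_zero_of_ord_ne_zero (by rw [ht]; decide))
  rcases P.mem_ball.1 (hz P hP) with h | h
  · rw [sub_eq_zero.1 h, hord]
  · have := P.ord_add_of_lt (g := z - t P ^ k P) h0 (by rw [hord]; exact (hN P hP).trans_le h)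
    rwa [add_sub_cancel, hord] at this

end Place

/-! ### Zeros of a function counted against `[F : K(x)]`. -/

open IntermediateField

open scoped IntermediateField.algebraAdjoinAdjoin in
/-- A family in a `K[x]`-stable subspace `S` that is linearly independent over `K` modulo `x S`
is linearly independent over `K(x)`. -/
theorem linearIndependent_adjoin {x : F} (hx : x ≠ 0) (S : Submodule K F)
    (hxS : ∀ f ∈ S, x * f ∈ S) {ι : Type*} [Fintype ι] (z : ι → F) (hz : ∀ i, z i ∈ S)
    (hind : ∀ c : ι → K, ∀ g ∈ S, ∑ i, c i • z i = x * g → c = 0) :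
    LinearIndependent K⟮x⟯ z := by
  have hS : ∀ p : K[X], ∀ f ∈ S, aeval x p * f ∈ S := by
    intro p f hf
    induction p using Polynomial.induction_on' with
    | add p q hp hq =>
      rw [map_add, add_mul]
      exact add_mem hp hq
    | monomial m a =>
      rw [aeval_monomial, mul_assoc, ← Algebra.smul_def]
      refine S.smul_mem a ?_
      induction m with
      | zero => simpa using hf
      | succ m ih =>
        rw [pow_succ', mul_assoc]
        exact hxS _ ih
  -- Independence over `K[x]`, by descent on the degree: modulo `x S` the constant terms give a
  -- relation over `K`, hence vanish, and the relation can be divided by `x`.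
  have key : ∀ N : ℕ, ∀ p : ι → K[X], (∀ i, (p i).natDegree < N) →
      ∑ i, aeval x (p i) * z i = 0 → ∀ i, p i = 0 := by
    intro N
    induction N with
    | zero => exact fun p hp _ i => absurd (hp i) (Nat.not_lt_zero _)
    | succ N ih =>
      intro p hp hsum
      have hsplit : ∀ i, aeval x (p i) * z i =
          (p i).coeff 0 • z i + x * (aeval x (p i).divX * z i) := by
        intro i
        conv_lhs => rw [← Polynomial.X_mul_divX_add (p i)]
        rw [map_add, map_mul, aeval_X, aeval_C, Algebra.smul_def]
        ring
      simp only [hsplit] at hsum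
      rw [Finset.sum_add_distrib, ← Finset.mul_sum] at hsum
      have hc : (fun i => (p i).coeff 0) = 0 := by
        refine hind _ (-∑ i, aeval x (p i).divX * z i)
          (neg_mem (sum_mem fun i _ => hS _ _ (hz i))) ?_
        rw [mul_neg]
        exact eq_neg_of_add_eq_zero_left hsum
      have hc' : ∀ i, (p i).coeff 0 = 0 := fun i => congrFun hc i
      simp only [hc', zero_smul, Finset.sum_const_zero, zero_add, mul_eq_zero, hx,
        false_or] at hsum
      intro i
      by_cases hN : N = 0
      · have h1 : (p i).natDegree = 0 := by
          have := hp i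
          omega
        rw [Polynomial.eq_C_of_natDegree_eq_zero h1, hc' i, map_zero]
      · have h0 := ih (fun i => (p i).divX) (fun i => by
          rw [Polynomial.natDegree_divX_eq_natDegree_tsub_one]
          have := hp i
          omega) hsum i
        rw [← Polynomial.X_mul_divX_add (p i)]
        rw [h0, hc' i]
        simp
  rw [← LinearIndependent.iff_fractionRing (Algebra.adjoin K {x}) K⟮x⟯,
    Fintype.linearIndependent_iff]
  intro a ha
  have hp : ∀ i, ∃ p : K[X], aeval x p = (a i : F) := by
    intro i
    exact (Algebra.adjoin_singleton_eq_range_aeval K x).le (a i).2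
  choose p hp using hp
  have h0 := key (∑ i, (p i).natDegree + 1) p (fun i => Nat.lt_succ_of_le
      (Finset.single_le_sum (f := fun i => (p i).natDegree) (fun _ _ => Nat.zero_le _)
        (Finset.mem_univ i))) (by
    rw [← ha]
    exact Finset.sum_congr rfl fun i _ => by rw [hp i]; rfl)
  intro i
  apply Subtype.ext
  rw [← hp i, h0 i]
  simp

theorem Place.algebraMap_notMem_ball_one (P : Place K F) {c : K} (hc : c ≠ 0) :
    algebraMap K F c ∉ P.ball 1 := by
  intro h
  have := P.mul_mem_ball h (P.algebraMap_mem_ball c⁻¹)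
  rw [← map_mul, mul_inv_cancel₀ hc, map_one, P.mem_ball_of_ne one_ne_zero, P.ord_one] at this
  omega

theorem mem_valuationSubring_of_isAlgebraic {V : ValuationSubring F}
    (hV : ∀ c : K, algebraMap K F c ∈ V) {g : F} (hg : IsAlgebraic K g) : g ∈ V := by
  have hint : IsIntegral V g := by
    obtain ⟨p, hp, hpg⟩ := hg.isIntegral
    refine ⟨p.map ((algebraMap K F).codRestrict V.toSubring hV), hp.map _, ?_⟩
    rw [eval₂_map]
    exact hpg
  obtain ⟨a, ha⟩ := IsIntegrallyClosed.isIntegral_iff.1 hint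
  rw [← ha]
  exact a.2

theorem Place.ord_eq_zero_of_isAlgebraic (P : Place K F) {f : F} (hf : IsAlgebraic K f) :
    P.ord f = 0 := by
  have key : ∀ g : F, IsAlgebraic K g → g ≠ 0 → 0 ≤ P.ord g := by
    intro g hg hg0
    rw [← P.mem_ball_of_ne hg0, ← P.mem_ring_iff]
    exact mem_valuationSubring_of_isAlgebraic P.algebraMap_mem hg
  by_cases h0 : f = 0
  · rw [h0, P.ord_zero]
  · have h1 := key f hf h0
    have h2 := key f⁻¹ hf.inv (inv_ne_zero h0)
    rw [P.ord_inv] at h2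
    omega

theorem Place.transcendental_of_ord_ne_zero (P : Place K F) {f : F} (h : P.ord f ≠ 0) :
    Transcendental K f := fun hf => h (P.ord_eq_zero_of_isAlgebraic hf)

/-- Lifts of a linearly independent family of residue classes, multiplied by the powers
`1, t, …, t ^ (k - 1)` of a local parameter, are linearly independent modulo elements of
valuation at least `k`. -/
theorem Place.eq_zero_of_sum_mem_ball (P : Place K F) {t : F} (ht : P.ord t = 1)
    {ι : Type*} [Fintype ι] (b : ι → P.ball 0)
    (hb : LinearIndependent K fun i => P.residueMap (b i))
    (k : ℕ) (c : ℕ → ι → K)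
    (h : ∑ a ∈ Finset.range k, ∑ i, c a i • (t ^ a * (b i : F)) ∈ P.ball k) :
    ∀ a < k, c a = 0 := by
  have ht0 : t ≠ 0 := P.ne_zero_of_ord_ne_zero (by omega)
  have htm : t ∈ P.ball 1 := P.mem_ball.2 (Or.inr ht.ge)
  have htinv : t⁻¹ ∈ P.ball (-1) := P.mem_ball.2 (Or.inr (by rw [P.ord_inv, ht]))
  induction k generalizing c with
  | zero => exact fun a ha => absurd ha (Nat.not_lt_zero _)
  | succ k ih =>
    rw [Finset.sum_range_succ'] at h
    have hfac : ∑ a ∈ Finset.range k, ∑ i, c (a + 1) i • (t ^ (a + 1) * (b i : F)) =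
        t * ∑ a ∈ Finset.range k, ∑ i, c (a + 1) i • (t ^ a * (b i : F)) := by
      simp only [Finset.mul_sum, mul_smul_comm, pow_succ']
      simp only [mul_assoc]
    have hmem : ∑ a ∈ Finset.range k, ∑ i, c (a + 1) i • (t ^ a * (b i : F)) ∈ P.ball 0 := by
      refine sum_mem fun a _ => sum_mem fun i _ => Submodule.smul_mem _ _ ?_
      have := P.mul_mem_ball (P.ball_anti (by positivity) (P.pow_mem_ball htm a)) (b i).2 (k := 0)
      simpa using this
    rw [hfac] at h
    have h0 : ∑ i, c 0 i • (t ^ 0 * (b i : F)) ∈ P.ball 1 := by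
      have h1 := P.ball_anti (show (1 : ℤ) ≤ ((k + 1 : ℕ) : ℤ) by push_cast; omega) h
      have h2 : t * ∑ a ∈ Finset.range k, ∑ i, c (a + 1) i • (t ^ a * (b i : F)) ∈ P.ball 1 := by
        simpa using P.mul_mem_ball htm hmem
      exact (Submodule.add_mem_iff_right _ h2).1 h1
    have hc0 : c 0 = 0 := by
      have h3 : P.residueMap (∑ i, c 0 i • b i) = 0 := by
        rw [P.residueMap_eq_zero_iff]
        simpa using h0
      rw [map_sum] at h3
      simp only [map_smul] at h3
      exact funext (Fintype.linearIndependent_iff.1 hb _ h3)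
    rw [hc0] at h
    simp only [Pi.zero_apply, zero_smul, Finset.sum_const_zero, add_zero] at h
    have h4 := P.mul_mem_ball htinv h
    rw [← mul_assoc, inv_mul_cancel₀ ht0, one_mul] at h4
    have h5 := ih (fun a => c (a + 1)) (by
      convert h4 using 2
      push_cast
      ring)
    intro a ha
    rcases a with _ | a
    · exact hc0
    · exact h5 a (by omega)

section FunctionField

variable [Algebra (RatFunc K) F] [IsScalarTower K (RatFunc K) F] [FunctionField K F]

/-- The zeros of `x` in `T`, weighted by the sizes of independent families of residue classes, are
bounded by the degree `[F : K(x)]`. -/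
theorem sum_ord_mul_card_le {x : F} (T : Finset (Place K F)) (hT : ∀ P ∈ T, 0 < P.ord x)
    (hx : Transcendental K x)
    (d : Place K F → ℕ) (b : ∀ P : Place K F, Fin (d P) → P.ball 0)
    (hb : ∀ P ∈ T, LinearIndependent K fun i => P.residueMap (b P i)) :
    ∑ P ∈ T, P.ord x * (d P : ℤ) ≤ Module.finrank K⟮x⟯ F := by
  classical
  have := FunctionField.finiteDimensional_of_adjoin_transcendental (K := F) hx
  have hx0 : x ≠ 0 := fun h => hx (h ▸ isAlgebraic_zero)
  choose t ht using fun P : Place K F => P.exists_ord_eq_one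
  let k : Place K F → ℕ := fun P => (P.ord x).toNat
  have hk : ∀ P ∈ T, (k P : ℤ) = P.ord x := fun P hP => Int.toNat_of_nonneg (hT P hP).le
  let N : ℕ := ∑ P ∈ T, k P
  have hN : ∀ P ∈ T, k P ≤ N := fun P hP =>
    Finset.single_le_sum (f := k) (fun _ _ => Nat.zero_le _) hP
  -- One index for each local element `t_P ^ a * b_{P,i}` with `a < ord_P x`; the functions `z`
  -- below approximate it at `P` and `0` at the other places of `T`.
  let ι := Σ P : T, Fin (k P) × Fin (d P)
  have happrox : ∀ i : ι, ∃ z : F,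
      z - t i.1 ^ (i.2.1 : ℕ) * b i.1 i.2.2 ∈ (i.1 : Place K F).ball N ∧
      ∀ Q ∈ T, Q ≠ i.1 → z ∈ Q.ball N := by
    intro i
    obtain ⟨z, hz⟩ := Place.weak_approximation T
      (fun Q => if Q = i.1 then t i.1 ^ (i.2.1 : ℕ) * b i.1 i.2.2 else 0) N
    refine ⟨z, by simpa using hz i.1 i.1.2, fun Q hQ hne => by simpa [hne] using hz Q hQ⟩
  choose z hz hz' using happrox
  let S : Submodule K F := ⨅ P ∈ T, P.ball 0
  have hS : ∀ f, f ∈ S ↔ ∀ P ∈ T, f ∈ P.ball 0 := fun f => by simp [S]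
  have hloc : ∀ i : ι, t i.1 ^ (i.2.1 : ℕ) * (b i.1 i.2.2 : F) ∈ (i.1 : Place K F).ball 0 := by
    intro i
    have h1 : t i.1 ∈ (i.1 : Place K F).ball 0 :=
      Place.mem_ball _ |>.2 (Or.inr (by rw [ht]; decide))
    simpa using Place.mul_mem_ball _ (Place.pow_mem_ball _ h1 (i.2.1 : ℕ)) (b i.1 i.2.2).2
  have hli : LinearIndependent K⟮x⟯ z := by
    refine linearIndependent_adjoin hx0 S ?_ z ?_ ?_
    · intro f hf
      rw [hS] at *
      intro P hP
      have := P.mul_mem_ball (P.mem_ball.2 (Or.inr (hT P hP).le)) (hf P hP)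
      simpa using this
    · intro i
      rw [hS]
      intro P hP
      by_cases hne : P = i.1
      · subst hne
        have := add_mem (Place.ball_anti _ (by positivity) (hz i)) (hloc i)
        simpa using this
      · exact P.ball_anti (by positivity) (hz' i P hP hne)
    · intro c g hg hsum
      rw [hS] at hg
      -- At `P`, both `x g` and the functions attached to other places have order at least `ord_P
      -- x`, so only the local combination at `P` survives.
      have hP : ∀ P : T, ∀ a : Fin (k P), ∀ j, c ⟨P, a, j⟩ = 0 := by
        intro P
        have hkN : (k P : ℤ) ≤ N := by exact_mod_cast hN P P.2
        have h1 : ∑ i, c i • z i ∈ (P : Place K F).ball (k P) := by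
          rw [hsum, hk P P.2]
          simpa using Place.mul_mem_ball _ (Place.mem_ball _ |>.2 (Or.inr le_rfl)) (hg P P.2)
        rw [Fintype.sum_sigma, ← Finset.add_sum_erase _ _ (Finset.mem_univ P)] at h1
        have h2 : ∑ Q ∈ Finset.univ.erase P, ∑ y, c ⟨Q, y⟩ • z ⟨Q, y⟩ ∈
            (P : Place K F).ball (k P) := by
          refine sum_mem fun Q hQ => sum_mem fun y _ => Submodule.smul_mem _ _ ?_
          refine Place.ball_anti _ hkN (hz' ⟨Q, y⟩ P P.2 fun h => ?_)
          exact Finset.ne_of_mem_erase hQ (Subtype.ext h.symm)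
        have h3 := (Submodule.add_mem_iff_left _ h2).1 h1
        have h4 : ∑ y : Fin (k P) × Fin (d P), c ⟨P, y⟩ • (t P ^ (y.1 : ℕ) * (b P y.2 : F)) ∈
            (P : Place K F).ball (k P) := by
          have : ∑ y : Fin (k P) × Fin (d P), c ⟨P, y⟩ • (t P ^ (y.1 : ℕ) * (b P y.2 : F)) =
              ∑ y, c ⟨P, y⟩ • z ⟨P, y⟩ -
              ∑ y : Fin (k P) × Fin (d P),
                c ⟨P, y⟩ • (z ⟨P, y⟩ - t P ^ (y.1 : ℕ) * (b P y.2 : F)) := by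
            rw [← Finset.sum_sub_distrib]
            refine Finset.sum_congr rfl fun y _ => ?_
            rw [← smul_sub, sub_sub_cancel]
          rw [this]
          refine sub_mem h3 (sum_mem fun y _ => Submodule.smul_mem _ _ ?_)
          exact Place.ball_anti _ hkN (hz ⟨P, y⟩)
        rw [Fintype.sum_prod_type] at h4
        have h5 := Place.eq_zero_of_sum_mem_ball (P : Place K F) (ht P) (b P) (hb P P.2) (k P)
          (fun a j => if h : a < k P then c ⟨P, ⟨a, h⟩, j⟩ else 0) (by
            rw [Finset.sum_range]
            simpa using h4)
        intro a j
        have := congrFun (h5 a a.2) j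
        simpa using this
      funext i
      exact hP i.1 i.2.1 i.2.2
  have hcard := hli.fintype_card_le_finrank
  rw [Fintype.card_sigma] at hcard
  simp only [Fintype.card_prod, Fintype.card_fin] at hcard
  rw [Finset.sum_coe_sort T (fun P => k P * d P)] at hcard
  calc ∑ P ∈ T, P.ord x * (d P : ℤ) = ∑ P ∈ T, (k P : ℤ) * (d P : ℤ) :=
        Finset.sum_congr rfl fun P hP => by rw [hk P hP]
    _ ≤ _ := by exact_mod_cast hcard

/-- For a local parameter `x`, the zero count with `T = {P}` bounds every independent set of residue
classes by `[F : K(x)]`. -/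
instance Place.finite_residue (P : Place K F) : Module.Finite K P.Residue := by
  classical
  obtain ⟨x, hx⟩ := P.exists_ord_eq_one
  have hrank : Module.rank K P.Residue ≤ Module.finrank K⟮x⟯ F := by
    refine rank_le fun s hs => ?_
    choose g hg using P.residueMap_surjective
    let b : Fin s.card → P.ball 0 := fun i => g (s.equivFin.symm i)
    have hb : LinearIndependent K fun i => P.residueMap (b i) := by
      simp only [b, hg]
      exact hs.comp _ s.equivFin.symm.injective
    have := sum_ord_mul_card_le {P} (x := x) (by simp [hx])
      (P.transcendental_of_ord_ne_zero (by omega))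
      (Function.update (fun _ => 0) P s.card)
      (fun Q => if h : Q = P then by
          subst h
          exact fun i => b (Fin.cast (by simp) i)
        else fun _ => 0) (by
        intro Q hQ
        obtain rfl := Finset.mem_singleton.1 hQ
        simp only [dif_pos]
        exact hb.comp (Fin.cast (by simp)) (Fin.cast_injective _))
    simpa [hx] using this
  exact Module.rank_lt_aleph0_iff.1 (hrank.trans_lt Cardinal.natCast_lt_aleph0)

theorem Place.degree_pos (P : Place K F) : 0 < P.degree := Module.finrank_pos

theorem sum_ord_mul_degree_le {x : F} (T : Finset (Place K F)) (hT : ∀ P ∈ T, 0 < P.ord x)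
    (hx : Transcendental K x) :
    ∑ P ∈ T, P.ord x * (P.degree : ℤ) ≤ Module.finrank K⟮x⟯ F := by
  choose g hg using fun P : Place K F => P.residueMap_surjective
  refine sum_ord_mul_card_le T hT hx Place.degree
    (fun P i => g P (Module.finBasis K P.Residue i)) fun P _ => ?_
  simp only [hg]
  exact (Module.finBasis K P.Residue).linearIndependent

theorem finite_setOf_ord_pos (x : F) : {P : Place K F | 0 < P.ord x}.Finite := by
  by_cases hx : Transcendental K x
  · by_contra hinf
    obtain ⟨T, hT, hcard⟩ := Set.Infinite.exists_subset_card_eq hinf (Module.finrank K⟮x⟯ F + 1)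
    have h1 := sum_ord_mul_degree_le T (fun P hP => hT hP) hx
    have h2 : ∑ P ∈ T, (1 : ℤ) ≤ ∑ P ∈ T, P.ord x * (P.degree : ℤ) := by
      refine Finset.sum_le_sum fun P hP => ?_
      have h3 : 0 < P.ord x := hT hP
      have h4 := P.degree_pos
      have : 0 < P.ord x * (P.degree : ℤ) := by positivity
      omega
    rw [Finset.sum_const, hcard] at h2
    simp at h2
    omega
  · convert Set.finite_empty
    ext P
    simp [P.ord_eq_zero_of_isAlgebraic (not_not.1 hx)]

theorem finite_setOf_ord_ne_zero (x : F) : {P : Place K F | P.ord x ≠ 0}.Finite := by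
  refine ((finite_setOf_ord_pos x).union (finite_setOf_ord_pos x⁻¹)).subset fun P hP => ?_
  have hP' : P.ord x ≠ 0 := hP
  rcases lt_or_gt_of_ne hP' with h | h
  · right
    change 0 < P.ord x⁻¹
    rw [P.ord_inv]
    omega
  · exact Or.inl h

end FunctionField

/-! ### Discreteness of valuation rings over `K` and existence of poles. -/

theorem transcendental_of_valuation_lt_one {V : ValuationSubring F}
    (hV : ∀ c : K, algebraMap K F c ∈ V) {y : F} (hy0 : y ≠ 0) (hy : V.valuation y < 1) :
    Transcendental K y := by
  intro halg
  have h := mem_valuationSubring_of_isAlgebraic hV halg.inv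
  rw [← V.valuation_le_one_iff, map_inv₀, inv_le_one₀ (zero_lt_iff.2 (by simpa using hy0))] at h
  exact absurd hy h.not_gt

theorem adjoin_simple_inv_le (x : F) : K⟮x⁻¹⟯ ≤ K⟮x⟯ := by
  rw [adjoin_simple_le_iff]
  exact inv_mem (mem_adjoin_simple_self K x)

theorem adjoin_simple_inv (x : F) : K⟮x⁻¹⟯ = K⟮x⟯ := by
  refine le_antisymm (adjoin_simple_inv_le x) ?_
  have := adjoin_simple_inv_le (K := K) x⁻¹
  rwa [inv_inv] at this

theorem linearIndependent_codRestrict {ι M : Type*} [AddCommGroup M] [Module K M] {v : ι → M}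
    (hv : LinearIndependent K v) {W : Submodule K M} (hW : ∀ i, v i ∈ W) :
    LinearIndependent K fun i => (⟨v i, hW i⟩ : W) :=
  LinearIndependent.of_comp W.subtype hv

theorem linearIndependent_pow_gen {x : F} (hx : Transcendental K x) (k : ℕ) :
    LinearIndependent K fun j : Fin k => AdjoinSimple.gen K x ^ (j : ℕ) := by
  have hg : Transcendental K (AdjoinSimple.gen K x) := by
    intro h
    refine hx ?_
    have := h.algebraMap (A := F)
    rwa [AdjoinSimple.algebraMap_gen] at this
  have h1 := (Polynomial.basisMonomials K).linearIndependent.map'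
    (aeval (AdjoinSimple.gen K x)).toLinearMap
    (LinearMap.ker_eq_bot.2 (transcendental_iff_injective.1 hg))
  simpa [Function.comp_def] using! h1.comp (fun j : Fin k => (j : ℕ)) Fin.val_injective

theorem linearIndependent_pow_mul {x : F} (hx : Transcendental K x) {ι : Type*} {u : ι → F}
    (hu : LinearIndependent K⟮x⟯ u) (k : ℕ) :
    LinearIndependent K fun ji : Fin k × ι => x ^ (ji.1 : ℕ) * u ji.2 :=
  linearIndependent_smul (linearIndependent_pow_gen hx k) hu

section FunctionField

variable [Algebra (RatFunc K) F] [IsScalarTower K (RatFunc K) F] [FunctionField K F]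

/-- Nonzero constants have value `1`, so a `K`-combination of elements with distinct values has the
largest value occurring. That value exceeds `V.valuation y`, so the elements are independent modulo
`y V`, hence over `K(y)`. -/
theorem card_le_finrank_of_valuation {V : ValuationSubring F}
    (hV : ∀ c : K, algebraMap K F c ∈ V) {y : F} (hy0 : y ≠ 0) (hy : V.valuation y < 1)
    {ι : Type*} [Fintype ι] (z : ι → F) (hinj : Function.Injective fun i => V.valuation (z i))
    (hz : ∀ i, z i ∈ V) (hyz : ∀ i, V.valuation y < V.valuation (z i)) :
    Fintype.card ι ≤ Module.finrank K⟮y⟯ F := by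
  classical
  have := FunctionField.finiteDimensional_of_adjoin_transcendental (K := F)
    (transcendental_of_valuation_lt_one hV hy0 hy)
  have hconst : ∀ c : K, c ≠ 0 → V.valuation (algebraMap K F c) = 1 := by
    intro c hc
    refine le_antisymm (V.valuation_le_one_iff _ |>.2 (hV c)) ?_
    have h := V.valuation_le_one_iff _ |>.2 (hV c⁻¹)
    rwa [map_inv₀, map_inv₀, inv_le_one₀ (zero_lt_iff.2 (by simpa using hc))] at h
  let S : Submodule K F :=
    { carrier := V
      add_mem' := fun ha hb => V.add_mem _ _ ha hb
      zero_mem' := V.zero_mem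
      smul_mem' := fun c f hf => by
        rw [Algebra.smul_def]
        exact V.mul_mem _ _ (hV c) hf }
  have hyV : y ∈ V := V.valuation_le_one_iff _ |>.1 hy.le
  refine (linearIndependent_adjoin hy0 S
    (fun f hf => V.mul_mem _ _ hyV hf) z hz ?_).fintype_card_le_finrank
  intro c g hg hsum
  by_contra hc
  obtain ⟨i₁, hi₁⟩ := Function.ne_iff.1 hc
  let T : Finset ι := Finset.univ.filter fun i => c i ≠ 0
  obtain ⟨j, hjT, hj⟩ := T.exists_max_image (fun i => V.valuation (z i))
    ⟨i₁, by simpa [T] using hi₁⟩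
  have hval : ∀ i ∈ T, V.valuation (c i • z i) = V.valuation (z i) := by
    intro i hi
    rw [Algebra.smul_def, map_mul, hconst _ (by simpa [T] using hi), one_mul]
  have hT : ∑ i, c i • z i = ∑ i ∈ T, c i • z i := by
    refine (Finset.sum_subset (Finset.subset_univ _) fun i _ hi => ?_).symm
    have : c i = 0 := by simpa [T] using hi
    rw [this, zero_smul]
  have h1 : V.valuation (∑ i ∈ T, c i • z i) = V.valuation (c j • z j) := by
    refine Valuation.map_sum_eq_of_lt _ hjT fun i hi => ?_
    rw [Finset.mem_sdiff, Finset.mem_singleton] at hi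
    rw [hval j hjT, hval i hi.1]
    exact lt_of_le_of_ne (hj i hi.1) fun h => hi.2 (hinj h)
  rw [← hT, hsum, hval j hjT, map_mul] at h1
  have h2 : V.valuation y * V.valuation g ≤ V.valuation y :=
    mul_le_of_le_one_right' (V.valuation_le_one_iff _ |>.2 hg)
  exact absurd (hyz j) (h1 ▸ h2).not_gt

theorem isDiscreteValuationRing_of_algebraMap_mem {V : ValuationSubring F}
    (hV : ∀ c : K, algebraMap K F c ∈ V) (htop : V ≠ ⊤) : IsDiscreteValuationRing V := by
  classical
  obtain ⟨x, hx⟩ : ∃ x : F, x ∉ V := by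
    by_contra! h
    exact htop (eq_top_iff.2 fun x _ => h x)
  have hx0 : x ≠ 0 := by
    rintro rfl
    exact hx V.zero_mem
  have hy0 : x⁻¹ ≠ 0 := inv_ne_zero hx0
  have hy : V.valuation x⁻¹ < 1 := by
    rw [← V.valuation_le_one_iff, not_le] at hx
    rw [map_inv₀]
    exact inv_lt_one_of_one_lt₀ hx
  have hyV : x⁻¹ ∈ V := V.valuation_le_one_iff _ |>.1 hy.le
  have hprin : IsPrincipalIdealRing V := by
    refine ⟨fun I => ?_⟩
    by_cases hI : I = ⊥
    · exact hI ▸ bot_isPrincipal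
    obtain ⟨w, hwI, hw0⟩ := Submodule.exists_mem_ne_zero_of_ne_bot hI
    have hw0' : (w : F) ≠ 0 := by simpa using hw0
    -- Only finitely many values of elements of `I` lie above that of `y`, and `w` realises one of
    -- them; an element of `I` with the largest value generates `I`.
    let y : F := w * x⁻¹
    have hyw : V.valuation y < V.valuation (w : F) := by
      rw [map_mul]
      exact mul_lt_of_lt_one_right (zero_lt_iff.2 (by simpa using hw0')) hy
    have hy1 : V.valuation y < 1 := hyw.trans_le (V.valuation_le_one w)
    let W : Set V.ValueGroup :=
      {γ | V.valuation y < γ ∧ ∃ z ∈ I, V.valuation ((z : V) : F) = γ}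
    have hfin : W.Finite := by
      by_contra hinf
      obtain ⟨T, hT, hcard⟩ := Set.Infinite.exists_subset_card_eq hinf (Module.finrank K⟮y⟯ F + 1)
      choose z hz hz' using fun γ : T => (hT γ.2).2
      have := card_le_finrank_of_valuation hV (mul_ne_zero hw0' hy0) hy1 (fun γ : T => (z γ : F))
        (fun γ δ h => Subtype.ext (by simpa [hz'] using h)) (fun γ => (z γ).2)
        (fun γ => by rw [hz']; exact (hT γ.2).1)
      rw [Fintype.card_coe, hcard] at this
      exact absurd this (by simp [y])
    obtain ⟨γ, ⟨hγ, z, hzI, hz⟩, hmax⟩ := Set.exists_max_image W id hfin ⟨_, hyw, w, hwI, rfl⟩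
    refine ⟨z, le_antisymm (fun a ha => ?_) ?_⟩
    · have hz0 : (z : F) ≠ 0 := by
        intro h0
        rw [h0, map_zero] at hz
        rw [← hz] at hγ
        exact absurd hγ not_lt_zero
      have hle : V.valuation (a : F) ≤ V.valuation (z : F) := by
        rcases le_or_gt (V.valuation (a : F)) (V.valuation y) with h | h
        · exact h.trans (hz ▸ hγ.le)
        · rw [hz]
          exact hmax _ ⟨h, a, ha, rfl⟩
      have hmem : (a : F) / z ∈ V := by
        rw [← V.valuation_le_one_iff, map_div₀]
        exact div_le_one_of_le₀ hle zero_le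
      refine Submodule.mem_span_singleton.2 ⟨⟨_, hmem⟩, Subtype.ext ?_⟩
      change (a : F) / z * z = a
      exact div_mul_cancel₀ _ hz0
    · rw [Submodule.span_singleton_le_iff_mem]
      exact hzI
  refine { toIsPrincipalIdealRing := hprin, not_a_field' := ?_ }
  intro hbot
  have h : (⟨x⁻¹, hyV⟩ : V) ∈ IsLocalRing.maximalIdeal V := V.valuation_lt_one_iff _ |>.2 hy
  rw [hbot, Ideal.mem_bot] at h
  exact hy0 (congrArg Subtype.val h)

theorem transcendental_algebraMap_X (K F : Type*) [Field K] [Field F] [Algebra K F]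
    [Algebra (RatFunc K) F] [IsScalarTower K (RatFunc K) F] :
    Transcendental K (algebraMap (RatFunc K) F RatFunc.X) := fun h =>
  RatFunc.transcendental_X ((isAlgebraic_algebraMap_iff (algebraMap (RatFunc K) F).injective).1 h)

/-- Every transcendental function has a pole. -/
theorem exists_ord_neg {x : F} (hx : Transcendental K x) : ∃ P : Place K F, P.ord x < 0 := by
  -- An integrally closed subring that misses `x` is contained in a valuation ring that misses `x`.
  have hx' : x ∉ (integralClosure K F).toSubring := fun h => hx (IsIntegral.isAlgebraic h)
  obtain ⟨V, hV, hxV⟩ := Subring.exists_le_valuationSubring_of_isIntegrallyClosedIn hx'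
  have hc : ∀ c : K, algebraMap K F c ∈ V := fun c => hV (algebraMap_mem (integralClosure K F) c)
  let P : Place K F := ⟨V, hc, isDiscreteValuationRing_of_algebraMap_mem hc fun h =>
    hxV (h ▸ ValuationSubring.mem_top _)⟩
  refine ⟨P, not_le.1 fun h => hxV ?_⟩
  change x ∈ P.ring
  rw [P.mem_ring_iff, P.mem_ball]
  exact Or.inr h

end FunctionField

/-! ### Divisors and Riemann-Roch spaces. -/

namespace Divisor

theorem deg_zero : deg (0 : Divisor K F) = 0 := Finsupp.sum_zero_index

theorem deg_add (A B : Divisor K F) : (A + B).deg = A.deg + B.deg :=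
  Finsupp.sum_add_index' (by simp) (fun _ _ _ => add_mul _ _ _)

theorem deg_neg (A : Divisor K F) : (-A).deg = -A.deg := by
  have := deg_add A (-A)
  rw [add_neg_cancel, deg_zero] at this
  linarith

theorem deg_sub (A B : Divisor K F) : (A - B).deg = A.deg - B.deg := by
  rw [sub_eq_add_neg, deg_add, deg_neg, sub_eq_add_neg]

theorem deg_nsmul (m : ℕ) (A : Divisor K F) : (m • A).deg = m * A.deg := by
  induction m with
  | zero => simp [deg_zero]
  | succ m ih =>
    rw [succ_nsmul, deg_add, ih]
    push_cast
    ring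

theorem deg_zsmul (m : ℤ) (A : Divisor K F) : (m • A).deg = m * A.deg := by
  obtain ⟨k, rfl | rfl⟩ := m.eq_nat_or_neg
  · rw [natCast_zsmul, deg_nsmul]
  · rw [neg_smul, deg_neg, natCast_zsmul, deg_nsmul, neg_mul]

theorem deg_single (P : Place K F) (m : ℤ) :
    deg (Finsupp.single P m : Divisor K F) = m * P.degree :=
  Finsupp.sum_single_index (by simp)

theorem deg_nonneg {A : Divisor K F} (hA : 0 ≤ A) : 0 ≤ A.deg :=
  Finset.sum_nonneg fun P _ => mul_nonneg (hA P) (by positivity)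

theorem mem_L {A : Divisor K F} {f : F} : f ∈ A.L ↔ ∀ P : Place K F, f ∈ P.ball (-A P) := by
  have h : f ∈ A.L ↔ (f = 0 ∨ ∀ P : Place K F, 0 ≤ P.ord f + A P) := Set.mem_ofPred
  rw [h]
  constructor
  · rintro (rfl | h) P
    · exact zero_mem _
    · exact P.mem_ball.2 (Or.inr (by linarith [h P]))
  · intro h
    by_cases hf : f = 0
    · exact Or.inl hf
    · refine Or.inr fun P => ?_
      have := (P.mem_ball_of_ne hf).1 (h P)
      linarith

theorem L_mono {A B : Divisor K F} (h : A ≤ B) : A.L ≤ B.L := fun _ hf =>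
  mem_L.2 fun P => P.ball_anti (neg_le_neg (h P)) (mem_L.1 hf P)

theorem mul_mem_L {A B : Divisor K F} {f g : F} (hf : f ∈ A.L) (hg : g ∈ B.L) :
    f * g ∈ (A + B).L := mem_L.2 fun P => by
  rw [Finsupp.add_apply, neg_add]
  exact P.mul_mem_ball (mem_L.1 hf P) (mem_L.1 hg P)

theorem one_mem_L_zero : (1 : F) ∈ (0 : Divisor K F).L := mem_L.2 fun P => by
  simpa using P.one_mem_ball

theorem pow_mem_L {A : Divisor K F} {f : F} (hf : f ∈ A.L) (m : ℕ) : f ^ m ∈ (m • A).L := by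
  induction m with
  | zero => simpa using one_mem_L_zero
  | succ m ih =>
    rw [pow_succ, succ_nsmul]
    exact mul_mem_L ih hf

end Divisor

/-! ### Finite dimension, degrees of principal divisors, Riemann's inequality. -/

section FunctionField

variable [Algebra (RatFunc K) F] [IsScalarTower K (RatFunc K) F] [FunctionField K F]

/-- One more order of vanishing at `P` costs at most `deg P` dimensions. -/
theorem Place.finrank_le_comap_ball_succ (P : Place K F) {V : Type*} [AddCommGroup V] [Module K V]
    (h : V →ₗ[K] F) (k : ℤ) (hk : ∀ v, h v ∈ P.ball k)
    [hfin : Module.Finite K ((P.ball (k + 1)).comap h)] :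
    Module.Finite K V ∧
      Module.finrank K V ≤ Module.finrank K ((P.ball (k + 1)).comap h) + P.degree := by
  obtain ⟨t, ht⟩ := P.exists_ord_eq_one
  have ht0 : t ≠ 0 := P.ne_zero_of_ord_ne_zero (by omega)
  have htk : ∀ m : ℤ, t ^ m ∈ P.ball m := fun m => P.mem_ball.2 (Or.inr (by
    rw [P.ord_zpow, ht, mul_one]))
  -- Scaling by `t ^ (-k)` makes the values of `h` integral at `P`; the residue then detects one
  -- further order of vanishing.
  let g₀ : V →ₗ[K] P.ball 0 :=
    ((LinearMap.mulLeft K (t ^ (-k))).comp h).codRestrict (P.ball 0) fun v => by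
      simpa using P.mul_mem_ball (htk (-k)) (hk v)
  let g : V →ₗ[K] P.Residue := P.residueMap.comp g₀
  have hker : LinearMap.ker g = (P.ball (k + 1)).comap h := by
    ext v
    rw [LinearMap.mem_ker, Submodule.mem_comap]
    change P.residueMap (g₀ v) = 0 ↔ _
    rw [P.residueMap_eq_zero_iff]
    change t ^ (-k) * h v ∈ P.ball 1 ↔ _
    constructor
    · intro hm
      have := P.mul_mem_ball (htk k) hm
      rwa [← mul_assoc, ← zpow_add₀ ht0, add_neg_cancel, zpow_zero, one_mul] at this
    · intro hm
      simpa using P.mul_mem_ball (htk (-k)) hm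
  rw [← hker] at hfin ⊢
  have hV : Module.Finite K V := by
    have : Module.Finite K (V ⧸ LinearMap.ker g) :=
      Module.Finite.equiv g.quotKerEquivRange.symm
    exact Module.Finite.of_submodule_quotient (LinearMap.ker g)
  refine ⟨hV, ?_⟩
  rw [← LinearMap.finrank_range_add_finrank_ker g, add_comm]
  exact Nat.add_le_add_left (Submodule.finrank_le _) _

namespace Divisor

theorem finite_L_add_single (A : Divisor K F) (P : Place K F) [hA : Module.Finite K A.L] :
    Module.Finite K (A + Finsupp.single P 1).L ∧
      (A + Finsupp.single P 1).dim ≤ A.dim + P.degree := by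
  classical
  let B : Divisor K F := A + Finsupp.single P 1
  have hB : ∀ Q, B Q = A Q + if P = Q then 1 else 0 := fun Q => by
    simp [B, Finsupp.single_apply]
  have hAB : A.L ≤ B.L := L_mono fun Q => by
    rw [hB]
    split_ifs <;> omega
  have hcomap : (P.ball (-B P + 1)).comap B.L.subtype = A.L.comap B.L.subtype := by
    ext f
    simp only [Submodule.mem_comap, Submodule.subtype_apply]
    rw [mem_L]
    constructor
    · intro h Q
      by_cases hQ : P = Q
      · subst hQ
        convert h using 2
        rw [hB, if_pos rfl]
        ring
      · have := mem_L.1 f.2 Q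
        rwa [hB, if_neg hQ, add_zero] at this
    · intro h
      convert h P using 2
      rw [hB, if_pos rfl]
      ring
  have e := Submodule.comapSubtypeEquivOfLe hAB
  have : Module.Finite K ((P.ball (-B P + 1)).comap B.L.subtype) := by
    rw [hcomap]
    exact Module.Finite.equiv e.symm
  have h := P.finrank_le_comap_ball_succ B.L.subtype (-B P) fun f => mem_L.1 f.2 P
  rw [hcomap, e.finrank_eq] at h
  exact h

theorem finite_L_add {A E : Divisor K F} (hE : 0 ≤ E) [hA : Module.Finite K A.L] :
    Module.Finite K (A + E).L ∧ ((A + E).dim : ℤ) ≤ A.dim + E.deg := by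
  let good : Divisor K F → Prop := fun E => ∀ A : Divisor K F, Module.Finite K A.L →
    Module.Finite K (A + E).L ∧ ((A + E).dim : ℤ) ≤ A.dim + E.deg
  have hadd : ∀ D E, good D → good E → good (D + E) := by
    intro D E hD hE A hA
    have h1 := hD A hA
    have h2 := hE (A + D) h1.1
    rw [← add_assoc, deg_add]
    exact ⟨h2.1, by linarith [h1.2, h2.2]⟩
  have hzero : good 0 := fun A hA => by
    rw [add_zero, deg_zero]
    exact ⟨hA, by omega⟩
  have hsingle : ∀ (P : Place K F) (m : ℕ), good (Finsupp.single P (m : ℤ)) := by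
    intro P m
    induction m with
    | zero => simpa using hzero
    | succ m ih =>
      rw [Nat.cast_succ, Finsupp.single_add]
      refine hadd _ _ ih fun A hA => ?_
      have := finite_L_add_single A P
      refine ⟨this.1, ?_⟩
      rw [deg_single, one_mul]
      exact_mod_cast this.2
  have : good E := by
    rw [← Finsupp.sum_single E]
    refine Finset.sum_induction _ good hadd hzero fun P _ => ?_
    obtain ⟨m, hm⟩ := Int.eq_ofNat_of_zero_le (hE P)
    rw [hm]
    exact hsingle P m
  exact this A hA

/-- A nonzero element vanishing at `P` is transcendental, so it has a pole and is not in `L(0)`.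
Hence `L(0)` embeds into the residue field of `P`. -/
instance finite_L_zero : Module.Finite K (0 : Divisor K F).L := by
  obtain ⟨P, -⟩ := exists_ord_neg (transcendental_algebraMap_X K F)
  have hmem : ∀ f ∈ (0 : Divisor K F).L, ∀ Q : Place K F, f ∈ Q.ball 0 := fun f hf Q => by
    simpa using mem_L.1 hf Q
  let g : (0 : Divisor K F).L →ₗ[K] P.Residue :=
    P.residueMap.comp (Submodule.inclusion fun f hf => hmem f hf P)
  refine Module.Finite.of_injective g ?_
  rw [← LinearMap.ker_eq_bot, LinearMap.ker_eq_bot']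
  intro f hf
  have hf1 : (f : F) ∈ P.ball 1 := (P.residueMap_eq_zero_iff _).1 hf
  by_contra hne
  have hf0 : (f : F) ≠ 0 := fun h => hne (Subtype.ext h)
  rw [P.mem_ball_of_ne hf0] at hf1
  obtain ⟨Q, hQ⟩ := exists_ord_neg (P.transcendental_of_ord_ne_zero (f := (f : F)) (by omega))
  have := (Q.mem_ball_of_ne hf0).1 (hmem f f.2 Q)
  omega

instance finite_L (A : Divisor K F) : Module.Finite K A.L := by
  have hfin : Module.Finite K (0 + A ⊔ 0 : Divisor K F).L := (finite_L_add le_sup_right).1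
  rw [zero_add] at hfin
  exact Submodule.finiteDimensional_of_le (S₂ := (A ⊔ 0).L) (L_mono le_sup_left)

/-- Since `deg - dim` is monotone, an upper bound for it at a large divisor passes to all smaller
ones. -/
theorem dim_le_dim_add {A B : Divisor K F} (h : A ≤ B) :
    (B.dim : ℤ) - B.deg ≤ A.dim - A.deg := by
  have := (finite_L_add (A := A) (sub_nonneg.2 h)).2
  rw [add_sub_cancel, deg_sub] at this
  linarith

/-- The principal divisor of `f` (zero for `f = 0`). -/
def princ (f : F) : Divisor K F :=
  Finsupp.ofSupportFinite (fun P => P.ord f) (finite_setOf_ord_ne_zero f)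

theorem princ_apply (f : F) (P : Place K F) : princ f P = P.ord f := rfl

/-- The pole divisor of `f`. -/
def poles (f : F) : Divisor K F := (-princ f) ⊔ 0

theorem poles_apply (f : F) (P : Place K F) : poles f P = max (-P.ord f) 0 := rfl

theorem poles_nonneg (f : F) : 0 ≤ (poles f : Divisor K F) := le_sup_right

theorem princ_eq (f : F) : (princ f : Divisor K F) = poles f⁻¹ - poles f := by
  ext P
  rw [Finsupp.sub_apply, princ_apply, poles_apply, poles_apply, P.ord_inv]
  omega

theorem mem_L_poles (f : F) : f ∈ (poles f : Divisor K F).L := mem_L.2 fun P => by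
  rw [P.mem_ball, poles_apply]
  right
  omega

theorem deg_poles_le {x : F} (hx : Transcendental K x) :
    (poles x : Divisor K F).deg ≤ Module.finrank K⟮x⟯ F := by
  have hx' : Transcendental K x⁻¹ := fun h => hx (by simpa using h.inv)
  have h := sum_ord_mul_degree_le (x := x⁻¹) (poles x : Divisor K F).support (fun P hP => by
    rw [Finsupp.mem_support_iff, poles_apply] at hP
    rw [P.ord_inv]
    omega) hx'
  rw [adjoin_simple_inv] at h
  refine le_trans (le_of_eq ?_) h
  refine Finset.sum_congr rfl fun P hP => ?_
  rw [Finsupp.mem_support_iff, poles_apply] at hP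
  change poles x P * _ = _
  rw [poles_apply, P.ord_inv]
  congr 1
  omega

/-- The products `x ^ j * u_i` with `j ≤ k` and `u_i` a basis over `K(x)` are independent over `K`;
`C` absorbs the poles of the `u_i`. -/
theorem exists_le_dim_poles {x : F} (hx : Transcendental K x) :
    ∃ C : Divisor K F, 0 ≤ C ∧ ∀ k : ℕ,
      (k + 1) * Module.finrank K⟮x⟯ F ≤ (k • poles x + C).dim := by
  have := FunctionField.finiteDimensional_of_adjoin_transcendental (K := F) hx
  let u := Module.finBasis K⟮x⟯ F
  let C : Divisor K F := ∑ i, poles (u i)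
  have hC : ∀ i, poles (u i) ≤ C := fun i =>
    Finset.single_le_sum (f := fun i => poles (u i)) (fun i _ => poles_nonneg _)
      (Finset.mem_univ i)
  refine ⟨C, Finset.sum_nonneg fun i _ => poles_nonneg _, fun k => ?_⟩
  have hli := linearIndependent_pow_mul hx u.linearIndependent (k + 1)
  have hmem : ∀ ji : Fin (k + 1) × Fin (Module.finrank K⟮x⟯ F),
      x ^ (ji.1 : ℕ) * u ji.2 ∈ (k • poles x + C).L := by
    rintro ⟨j, i⟩
    have h1 : x ^ (j : ℕ) ∈ (k • poles x : Divisor K F).L :=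
      L_mono (nsmul_le_nsmul_left (poles_nonneg x) (Nat.lt_succ_iff.1 j.2))
        (pow_mem_L (mem_L_poles x) j)
    exact mul_mem_L h1 (L_mono (hC i) (mem_L_poles (u i)))
  have hcard := (linearIndependent_codRestrict hli hmem).fintype_card_le_finrank
  rw [Fintype.card_prod, Fintype.card_fin, Fintype.card_fin] at hcard
  exact hcard

theorem deg_poles {x : F} (hx : Transcendental K x) :
    (poles x : Divisor K F).deg = Module.finrank K⟮x⟯ F := by
  refine le_antisymm (deg_poles_le hx) ?_
  obtain ⟨C, hC, h⟩ := exists_le_dim_poles hx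
  by_contra hlt
  push Not at hlt
  set m : ℤ := (Module.finrank K⟮x⟯ F : ℤ) with hm
  have hbound : ∀ k : ℕ, (k + 1) * m ≤
      (0 : Divisor K F).dim + (k * (poles x : Divisor K F).deg + C.deg) := by
    intro k
    have h1 : (0 : Divisor K F) ≤ k • poles x + C :=
      add_nonneg (nsmul_nonneg (poles_nonneg x) k) hC
    have h2 := dim_le_dim_add h1
    rw [deg_zero, deg_add, deg_nsmul] at h2
    have h3 : ((k : ℤ) + 1) * m ≤ (k • poles x + C).dim := by
      rw [hm]
      exact_mod_cast h k
    linarith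
  -- If `deg (poles x) ≤ m - 1`, the bound reads `k + m ≤ dim L(0) + deg C`, which fails for this
  -- `k` as `m > 0`.
  have h1 := hbound ((0 : Divisor K F).dim + C.deg).toNat
  have h2 := Int.self_le_toNat ((0 : Divisor K F).dim + C.deg)
  have h3 : (0 : ℤ) ≤ m := by positivity
  have h4 : (0 : ℤ) ≤ (poles x : Divisor K F).deg := deg_nonneg (poles_nonneg x)
  nlinarith

theorem deg_princ (f : F) : (princ f : Divisor K F).deg = 0 := by
  by_cases hf : Transcendental K f
  · have hf' : Transcendental K f⁻¹ := fun h => hf (by simpa using h.inv)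
    rw [princ_eq, deg_sub, deg_poles hf, deg_poles hf', adjoin_simple_inv, sub_self]
  · have : (princ f : Divisor K F) = 0 := by
      ext P
      exact P.ord_eq_zero_of_isAlgebraic (not_not.1 hf)
    rw [this, deg_zero]

theorem deg_nonneg_of_mem_L {A : Divisor K F} {f : F} (hf : f ∈ A.L) (hf0 : f ≠ 0) :
    0 ≤ A.deg := by
  have h : 0 ≤ princ f + A := fun P => by
    have := (P.mem_ball_of_ne hf0).1 (mem_L.1 hf P)
    rw [Finsupp.add_apply, princ_apply, Finsupp.zero_apply]
    linarith
  have := deg_nonneg h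
  rwa [deg_add, deg_princ, zero_add] at this

theorem dim_sub_princ_le (A : Divisor K F) {z : F} (hz : z ≠ 0) :
    (A - princ z).dim ≤ A.dim := by
  have hmem : ∀ f ∈ (A - princ z).L, z⁻¹ * f ∈ A.L := by
    intro f hf
    have h1 : z⁻¹ ∈ (princ z : Divisor K F).L := mem_L.2 fun P => by
      rw [P.mem_ball, P.ord_inv, princ_apply]
      exact Or.inr le_rfl
    have := mul_mem_L h1 hf
    rwa [add_sub_cancel] at this
  let g : (A - princ z).L →ₗ[K] A.L :=
    ((LinearMap.mulLeft K z⁻¹).comp (A - princ z).L.subtype).codRestrict A.L fun f => hmem f f.2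
  refine LinearMap.finrank_le_finrank_of_injective (f := g) fun a b hab => ?_
  have h := congrArg Subtype.val hab
  exact Subtype.ext (mul_left_cancel₀ (inv_ne_zero hz) h)

/-- Riemann's theorem: `deg A - dim L(A)` is bounded. -/
theorem bddAbove_deg_sub_dim :
    BddAbove (Set.range fun A : Divisor K F => A.deg - (A.dim : ℤ) + 1) := by
  have hx := transcendental_algebraMap_X K F
  set x := algebraMap (RatFunc K) F RatFunc.X
  have := FunctionField.finiteDimensional_of_adjoin_transcendental (K := F) hx
  obtain ⟨C, hC, h⟩ := exists_le_dim_poles hx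
  set B : Divisor K F := poles x
  have hB : (0 : ℤ) < B.deg := by
    rw [deg_poles hx]
    exact_mod_cast Module.finrank_pos
  have hkB : ∀ k : ℕ, (k • B).deg - (k • B).dim ≤ C.deg := by
    intro k
    have h1 := dim_le_dim_add (le_add_of_nonneg_right hC : k • B ≤ k • B + C)
    have h2 : ((k : ℤ) + 1) * B.deg ≤ (k • B + C).dim := by
      rw [deg_poles hx]
      exact_mod_cast h k
    rw [deg_add, deg_nsmul] at h1
    rw [deg_nsmul]
    linarith
  refine ⟨C.deg + 1, ?_⟩
  rintro _ ⟨A, rfl⟩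
  dsimp only
  have hA0 := dim_le_dim_add (le_sup_left : A ≤ A ⊔ 0)
  set A₀ : Divisor K F := A ⊔ 0
  have hA₀ : 0 ≤ A₀ := le_sup_right
  -- Large enough for `L(k B - A₀)` to contain some `z ≠ 0`; then `A₀ - (z) ≤ k B`, and the bound
  -- for `k B` passes to `A₀`.
  let k : ℕ := (C.deg + A₀.deg + 1).toNat
  have hk : C.deg + A₀.deg + 1 ≤ k := Int.self_le_toNat _
  have hpos : 0 < (k • B - A₀).dim := by
    have h1 := dim_le_dim_add (sub_le_self (k • B) hA₀)
    have h2 := hkB k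
    rw [deg_sub] at h1
    rw [deg_nsmul] at h1 h2
    have h3 := deg_nonneg hA₀
    have h4 := deg_nonneg hC
    have h5 : (k : ℤ) ≤ k * B.deg := le_mul_of_one_le_right (by positivity) hB
    zify
    linarith
  obtain ⟨⟨z, hz⟩, hz0⟩ := Module.finrank_pos_iff_exists_ne_zero.1 hpos
  have hz0' : z ≠ 0 := fun h => hz0 (Subtype.ext h)
  have hle : A₀ - princ z ≤ k • B := fun P => by
    have h1 := (P.mem_ball_of_ne hz0').1 (mem_L.1 hz P)
    rw [Finsupp.sub_apply] at h1 ⊢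
    rw [princ_apply]
    linarith
  have h1 := dim_le_dim_add hle
  have h2 := hkB k
  have h3 := dim_sub_princ_le A₀ hz0'
  rw [deg_sub, deg_princ] at h1
  zify at h3
  linarith

/-- Riemann's inequality. -/
theorem riemann_inequality (A : Divisor K F) : A.deg + 1 - genus K F ≤ A.dim := by
  have h1 := le_ciSup bddAbove_deg_sub_dim A
  have h2 : (⨆ A : Divisor K F, (A.deg - (A.dim : ℤ) + 1)) ≤ genus K F := Int.self_le_toNat _
  linarith

/-- A multiple of the rational place `P₀` has the right degree; a principal divisor of order one at
`P₀` and zero at the other `P i` moves it off `D`. -/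
theorem exists_supportDisjoint_deg_eq {n : ℕ} (hn : 0 < n) (P : Fin n → Place K F)
    (hrat : (P ⟨0, hn⟩).IsRational) (m : ℤ) :
    ∃ A : Divisor K F, SupportDisjoint P A ∧ A.deg = m := by
  classical
  set P₀ := P ⟨0, hn⟩
  obtain ⟨z, hz⟩ := Place.exists_forall_ord_eq (Finset.univ.image P)
    (fun Q => if P₀ = Q then 1 else 0)
  refine ⟨m • (Finsupp.single P₀ 1 - princ z), fun i => ?_, ?_⟩
  · have := hz (P i) (Finset.mem_image_of_mem _ (Finset.mem_univ i))
    rw [Finsupp.smul_apply, Finsupp.sub_apply, princ_apply, this, Finsupp.single_apply, sub_self,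
      smul_zero]
  · rw [deg_zsmul, deg_sub, deg_princ, deg_single, show P₀.degree = 1 from hrat]
    simp

end Divisor

end FunctionField

/-! ### Local expansions and zeros with multiplicity. -/

namespace Place

theorem algebraMap_residue_surjective {P : Place K F} (hP : P.IsRational) :
    Function.Surjective (algebraMap K P.Residue) := by
  intro a
  obtain ⟨c, hc⟩ := (finrank_eq_one_iff_of_nonzero' (1 : P.Residue) one_ne_zero).1 hP a
  exact ⟨c, by rw [← hc, Algebra.smul_def, mul_one]⟩

theorem sub_eval_mem_ball_one {P : Place K F} (hP : P.IsRational) {f : F} (hf : f ∈ P.ball 0) :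
    f - algebraMap K F (P.eval f) ∈ P.ball 1 := by
  have hfr : f ∈ P.ring := P.mem_ring_iff.2 hf
  have h1 : algebraMap K P.Residue (P.eval f) = IsLocalRing.residue P.ring ⟨f, hfr⟩ := by
    rw [eval, dif_pos hfr]
    exact Function.invFun_eq (algebraMap_residue_surjective hP _)
  have h2 := (P.mem_ball_one_iff (⟨f, hfr⟩ - algebraMap K P.ring (P.eval f))).2 (by
    rw [← IsLocalRing.residue_eq_zero_iff, map_sub, ← h1]
    exact sub_self _)
  exact h2

theorem HasExpansion.mem_ball {P : Place K F} {φ h : F} {c : ℕ → K} (hc : P.HasExpansion φ h c)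
    {N : ℕ} (hN : ∀ a < N, c a = 0) : h ∈ P.ball N := by
  have := hc N
  rw [Finset.sum_eq_zero fun a ha => by rw [hN a (Finset.mem_range.1 ha), map_zero, zero_mul],
    sub_zero] at this
  exact P.mem_ball.2 this

theorem exists_hasExpansion {P : Place K F} (hP : P.IsRational) {φ h : F} (hφ : P.ord φ = 1)
    {N : ℕ} (hh : h ∈ P.ball N) : ∃ c : ℕ → K, P.HasExpansion φ h c ∧ ∀ a < N, c a = 0 := by
  have hφ0 : φ ≠ 0 := P.ne_zero_of_ord_ne_zero (by omega)
  have hφm : φ ∈ P.ball 1 := P.mem_ball.2 (Or.inr hφ.ge)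
  have hφi : φ⁻¹ ∈ P.ball (-1) := P.mem_ball.2 (Or.inr (by rw [P.ord_inv, hφ]))
  -- Successive tails of the expansion: subtract the value at `P`, then divide by `φ`. The digits
  -- are the values of the tails.
  let u : ℕ → F := fun a => Nat.rec h (fun _ y => φ⁻¹ * (y - algebraMap K F (P.eval y))) a
  have hu0 : u 0 = h := rfl
  have hus : ∀ a, u (a + 1) = φ⁻¹ * (u a - algebraMap K F (P.eval (u a))) := fun a => rfl
  have hmem : ∀ a, u a ∈ P.ball 0 := by
    intro a
    induction a with
    | zero => exact P.ball_anti (by positivity) hh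
    | succ a ih =>
      rw [hus]
      simpa using P.mul_mem_ball hφi (sub_eval_mem_ball_one hP ih)
  have heval : ∀ f ∈ P.ball 1, P.eval f = 0 := by
    intro f hf
    by_contra hne
    have h1 := sub_eval_mem_ball_one hP (P.ball_anti (by norm_num) hf)
    have h2 := sub_mem hf h1
    rw [sub_sub_cancel] at h2
    exact P.algebraMap_notMem_ball_one hne h2
  have hsum : ∀ M : ℕ, h - ∑ a ∈ Finset.range M, algebraMap K F (P.eval (u a)) * φ ^ a =
      φ ^ M * u M := by
    intro M
    induction M with
    | zero => simp [hu0]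
    | succ M ih =>
      rw [Finset.sum_range_succ, ← sub_sub, ih, hus]
      field_simp
      ring
  have hvan : ∀ a ≤ N, u a ∈ P.ball ((N : ℤ) - a) := by
    intro a
    induction a with
    | zero => exact fun _ => by simpa [hu0] using hh
    | succ a ih =>
      intro ha
      have h1 := ih (by omega)
      have h2 := heval (u a) (P.ball_anti (by omega) h1)
      rw [hus, h2, map_zero, sub_zero]
      have := P.mul_mem_ball hφi h1
      convert this using 2
      push_cast
      ring
  refine ⟨fun a => P.eval (u a), fun M => ?_, fun a ha => heval _ ?_⟩
  · rw [hsum, ← P.mem_ball]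
    have := P.mul_mem_ball (P.pow_mem_ball hφm M) (hmem M)
    simpa using this
  · exact P.ball_anti (by omega) (hvan a ha.le)

/-- With its converse below, this replaces the expansions by conditions on orders. The truncated `m
- b` leaves only integrality at `P` when `b ≥ m`. -/
theorem HasZeroOfMultAtLeast.coeff_mem_ball {P : Place K F} {r : K} {m : ℕ} {Q : F[X]}
    (h : P.HasZeroOfMultAtLeast r m Q) (b : ℕ) :
    (taylor (algebraMap K F r) Q).coeff b ∈ P.ball ((m - b : ℕ) : ℤ) := by
  obtain ⟨φ, -, c, hc, h0⟩ := h
  exact (hc b).mem_ball fun a ha => h0 a b (by omega)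

theorem hasZeroOfMultAtLeast_of_coeff_mem {P : Place K F} (hP : P.IsRational) {r : K} {m : ℕ}
    {Q : F[X]}
    (h : ∀ b, (taylor (algebraMap K F r) Q).coeff b ∈ P.ball ((m - b : ℕ) : ℤ)) :
    P.HasZeroOfMultAtLeast r m Q := by
  obtain ⟨φ, hφ⟩ := P.exists_ord_eq_one
  choose c hc h0 using fun b => exists_hasExpansion hP hφ (h b)
  exact ⟨φ, hφ, fun a b => c b a, hc, fun a b hab => h0 b a (by omega)⟩

theorem HasZeroOfMultAtLeast.eval_mem_ball {P : Place K F} {r : K} {m : ℕ} {Q : F[X]}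
    (h : P.HasZeroOfMultAtLeast r m Q) {f : F} (hf : f - algebraMap K F r ∈ P.ball 1) :
    Q.eval f ∈ P.ball m := by
  rw [← taylor_eval_sub (algebraMap K F r), eval_eq_sum_range]
  refine sum_mem fun b _ => P.ball_anti ?_ (P.mul_mem_ball (h.coeff_mem_ball b)
    (P.pow_mem_ball hf b))
  omega

end Place

/-! ### Polynomials in `z ^ q`: translation and roots. -/

/-- The polynomial `∑_{j ≤ ℓ} v_j z ^ (q j)`. -/
def insepPoly (q ℓ : ℕ) (v : ℕ → F) : F[X] :=
  ∑ j ∈ Finset.range (ℓ + 1), C (v j) * X ^ (q * j)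

/-- The coefficients of `∑_{j ≤ ℓ} v_j (z + a) ^ (q j)` in characteristic `p`, `q` a power
of `p`. -/
def shiftCoeff (q ℓ : ℕ) (v : ℕ → F) (a : F) (b : ℕ) : F :=
  ∑ j ∈ Finset.range (ℓ + 1), (j.choose b : F) * a ^ (q * (j - b)) * v j

theorem coeff_insepPoly_mul {q : ℕ} (hq : 0 < q) {ℓ : ℕ} (v : ℕ → F) {b : ℕ} (hb : b ≤ ℓ) :
    (insepPoly q ℓ v).coeff (q * b) = v b := by
  rw [insepPoly, finsetSum_coeff, Finset.sum_eq_single b]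
  · simp
  · intro j _ hj
    rw [coeff_C_mul, coeff_X_pow, if_neg, mul_zero]
    exact fun h => hj (Nat.eq_of_mul_eq_mul_left hq h).symm
  · intro h
    exact absurd (Finset.mem_range.2 (Nat.lt_succ_of_le hb)) h

theorem coeff_insepPoly_eq_zero {q ℓ : ℕ} (v : ℕ → F) {m : ℕ} (hm : ∀ b ≤ ℓ, m ≠ q * b) :
    (insepPoly q ℓ v).coeff m = 0 := by
  rw [insepPoly, finsetSum_coeff]
  refine Finset.sum_eq_zero fun j hj => ?_
  rw [coeff_C_mul, coeff_X_pow, if_neg (hm j (Nat.lt_succ_iff.1 (Finset.mem_range.1 hj))),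
    mul_zero]

/-- Additivity of the `p ^ e`-th power turns `(z + a) ^ (p ^ e * j)` into a binomial expansion in `z
^ p ^ e`. -/
theorem taylor_insepPoly (p : ℕ) [Fact p.Prime] [CharP F p] (e ℓ : ℕ) (v : ℕ → F) (a : F) :
    taylor a (insepPoly (p ^ e) ℓ v) = insepPoly (p ^ e) ℓ (shiftCoeff (p ^ e) ℓ v a) := by
  have hterm : ∀ j ∈ Finset.range (ℓ + 1), taylor a (C (v j) * X ^ (p ^ e * j)) =
      ∑ b ∈ Finset.range (ℓ + 1),
        C ((j.choose b : F) * a ^ (p ^ e * (j - b)) * v j) * X ^ (p ^ e * b) := by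
    intro j hj
    rw [taylor_mul, taylor_C, taylor_pow, taylor_X, pow_mul, add_pow_char_pow, add_pow,
      Finset.mul_sum]
    have hsub : Finset.range (j + 1) ⊆ Finset.range (ℓ + 1) := by
      rw [Finset.range_subset_range]
      exact Finset.mem_range.1 hj
    rw [← Finset.sum_subset hsub fun b _ hb => by
      rw [Finset.mem_range, not_lt] at hb
      rw [Nat.choose_eq_zero_of_lt (by omega)]
      simp]
    refine Finset.sum_congr rfl fun b _ => ?_
    simp only [map_mul, map_pow, map_natCast, pow_mul]
    ring
  rw [insepPoly, map_sum, Finset.sum_congr rfl hterm, Finset.sum_comm]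
  simp only [insepPoly, shiftCoeff, map_sum, Finset.sum_mul]

/-- Frobenius sends the roots injectively to roots of `∑ v_j z ^ j`, whose degree is at most `ℓ`:
inseparability does not enlarge the list. -/
theorem encard_roots_insepPoly_le (p : ℕ) [Fact p.Prime] [CharP F p] (e ℓ : ℕ) (v : ℕ → F)
    (h : insepPoly (p ^ e) ℓ v ≠ 0) :
    {f : F | (insepPoly (p ^ e) ℓ v).eval f = 0}.encard ≤ ℓ := by
  classical
  let R : F[X] := ∑ j ∈ Finset.range (ℓ + 1), C (v j) * X ^ j
  have hR : insepPoly (p ^ e) ℓ v = expand F (p ^ e) R := by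
    simp [R, insepPoly, pow_mul]
  have hR0 : R ≠ 0 := by
    rintro h0
    rw [hR, h0, map_zero] at h
    exact h rfl
  have hdeg : R.natDegree ≤ ℓ := natDegree_sum_le_of_forall_le _ _ fun j hj =>
    (natDegree_C_mul_X_pow_le _ _).trans (Nat.lt_succ_iff.1 (Finset.mem_range.1 hj))
  have hinj : Function.Injective fun f : F => f ^ p ^ e := by
    intro f g hfg
    exact iterateFrobenius_inj F p e hfg
  calc {f : F | (insepPoly (p ^ e) ℓ v).eval f = 0}.encard
      = ((fun f : F => f ^ p ^ e) '' {f : F | (insepPoly (p ^ e) ℓ v).eval f = 0}).encard :=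
        (hinj.encard_image _).symm
    _ ≤ (R.roots.toFinset : Set F).encard := by
        refine Set.encard_le_encard ?_
        rintro _ ⟨f, hf, rfl⟩
        rw [Set.mem_ofPred_eq, hR, expand_eval] at hf
        simpa [hR0] using hf
    _ ≤ ℓ := by
        rw [Set.encard_coe_eq_coe_finsetCard]
        exact_mod_cast (Multiset.toFinset_card_le _).trans ((card_roots' R).trans hdeg)

/-! ### Counting linear conditions. -/

section Codim

variable {V : Type*} [AddCommGroup V] [Module K V] [Module.Finite K V]

theorem finrank_le_finrank_biInf_add {ι : Type*} (s : Finset ι) (W : ι → Submodule K V)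
    (κ : ι → ℕ) (h : ∀ i ∈ s, Module.finrank K V ≤ Module.finrank K (W i) + κ i) :
    Module.finrank K V ≤
      Module.finrank K (⨅ i ∈ s, W i : Submodule K V) + ∑ i ∈ s, κ i := by
  classical
  induction s using Finset.induction_on with
  | empty =>
    have : (⨅ i ∈ (∅ : Finset ι), W i) = ⊤ := by simp
    rw [this, finrank_top]
    simp
  | insert i s hi ih =>
    rw [Finset.iInf_insert, Finset.sum_insert hi]
    have h1 := h i (Finset.mem_insert_self _ _)
    have h2 := ih fun j hj => h j (Finset.mem_insert_of_mem hj)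
    have h3 := Submodule.finrank_sup_add_finrank_inf_eq (W i) (⨅ j ∈ s, W j)
    have h4 := Submodule.finrank_le (W i ⊔ ⨅ j ∈ s, W j)
    omega

variable [Algebra (RatFunc K) F] [IsScalarTower K (RatFunc K) F] [FunctionField K F]

/-- Each of the `k` orders of vanishing costs at most `deg P = 1` dimension. -/
theorem Place.finrank_le_finrank_comap_ball_add {P : Place K F} (hP : P.IsRational)
    (h : V →ₗ[K] F) (h0 : ∀ v, h v ∈ P.ball 0) (k : ℕ) :
    Module.finrank K V ≤ Module.finrank K ((P.ball k).comap h) + k := by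
  induction k with
  | zero =>
    have : (P.ball ((0 : ℕ) : ℤ)).comap h = ⊤ := eq_top_iff.2 fun v _ => h0 v
    rw [this, finrank_top]
    rfl
  | succ k ih =>
    let W := (P.ball k).comap h
    have h1 := (P.finrank_le_comap_ball_succ (h.comp W.subtype) k fun v => v.2).2
    have hle : (P.ball ((k + 1 : ℕ) : ℤ)).comap h ≤ W :=
      Submodule.comap_mono (P.ball_anti (by push_cast; omega))
    have e := Submodule.comapSubtypeEquivOfLe hle
    have h2 : Module.finrank K ((P.ball ((k : ℤ) + 1)).comap (h.comp W.subtype)) =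
        Module.finrank K ((P.ball ((k + 1 : ℕ) : ℤ)).comap h) := by
      rw [← e.finrank_eq]
      rfl
    rw [h2, show P.degree = 1 from hP] at h1
    change _ ≤ Module.finrank K W + k at ih
    omega

end Codim

/-! ### Interpolation polynomials: existence and vanishing. -/

section Interpolation

variable {n : ℕ}

/-- The factor `a ^ (q * (j - b))` makes up for the weaker condition on `v j` when `j > b`. -/
theorem shiftCoeff_mem_ball (P : Place K F) {q ℓ s : ℕ} {v : ℕ → F} {a : F}
    (ha : a ∈ P.ball 1) (hv : ∀ j ≤ ℓ, v j ∈ P.ball ((q * (s - j) : ℕ) : ℤ)) (b : ℕ) :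
    shiftCoeff q ℓ v a b ∈ P.ball ((q * (s - b) : ℕ) : ℤ) := by
  refine sum_mem fun j hj => ?_
  rcases lt_or_ge j b with hjb | hjb
  · simp [Nat.choose_eq_zero_of_lt hjb]
  · have h1 := P.mul_mem_ball (P.pow_mem_ball ha (q * (j - b)))
      (hv j (Nat.lt_succ_iff.1 (Finset.mem_range.1 hj)))
    have h2 : (q * (s - b) : ℕ) ≤ q * (j - b) + q * (s - j) := by
      rw [← mul_add]
      exact Nat.mul_le_mul_left _ (by omega)
    rw [mul_assoc, ← nsmul_eq_mul]
    exact nsmul_mem (P.ball_anti (by rw [mul_one]; exact_mod_cast h2) h1) _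

theorem shiftCoeff_mem_ball_zero (P : Place K F) {q ℓ : ℕ} {v : ℕ → F} {a : F}
    (ha : a ∈ P.ball 0) (hv : ∀ j, v j ∈ P.ball 0) (b : ℕ) :
    shiftCoeff q ℓ v a b ∈ P.ball 0 := by
  refine sum_mem fun j _ => ?_
  rw [mul_assoc, ← nsmul_eq_mul]
  refine nsmul_mem ?_ _
  simpa using P.mul_mem_ball (P.pow_mem_ball ha (q * (j - b))) (hv j)

/-- The factor `a ^ (q * (j - b))` lies in `L(q (j - b) G)`, so translation by an element of `L(G)`
respects the spaces prescribed for the coefficients. -/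
theorem shiftCoeff_mem_L {A G : Divisor K F} {q ℓ : ℕ} {v : ℕ → F} {a : F} (ha : a ∈ G.L)
    (hv : ∀ j, v j ∈ (A - (q * j) • G).L) (b : ℕ) :
    shiftCoeff q ℓ v a b ∈ (A - (q * b) • G).L := by
  refine sum_mem fun j _ => ?_
  rcases lt_or_ge j b with hjb | hjb
  · simp [Nat.choose_eq_zero_of_lt hjb]
  · have h1 := Divisor.mul_mem_L (Divisor.pow_mem_L ha (q * (j - b))) (hv j)
    have h2 : (q * (j - b)) • G + (A - (q * j) • G) = A - (q * b) • G := by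
      have : q * j = q * (j - b) + q * b := by
        rw [← mul_add, Nat.sub_add_cancel hjb]
      rw [this, add_smul]
      abel
    rw [mul_assoc, ← nsmul_eq_mul]
    exact nsmul_mem (h2 ▸ h1) _

/-- The `K`-linear map that extends a tuple `(v_1, …, v_ℓ)` by zero and reads off `v_j`. -/
def tupleCoeff {ℓ : ℕ} (M : ℕ → Submodule K F) (j : ℕ) :
    (∀ i : Fin ℓ, M (i + 1)) →ₗ[K] F :=
  if h : 1 ≤ j ∧ j ≤ ℓ then
    (M (j - 1 + 1)).subtype.comp (LinearMap.proj (⟨j - 1, by omega⟩ : Fin ℓ))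
  else 0

theorem tupleCoeff_succ {ℓ : ℕ} (M : ℕ → Submodule K F) (v : ∀ i : Fin ℓ, M (i + 1)) (i : Fin ℓ) :
    tupleCoeff M (i + 1) v = v i := by
  rw [tupleCoeff, dif_pos ⟨by omega, by omega⟩]
  rfl

theorem tupleCoeff_mem {ℓ : ℕ} (M : ℕ → Submodule K F) (j : ℕ) (v : ∀ i : Fin ℓ, M (i + 1)) :
    tupleCoeff M j v ∈ M j := by
  by_cases h : 1 ≤ j ∧ j ≤ ℓ
  · obtain ⟨i, rfl⟩ : ∃ i, j = i + 1 := ⟨j - 1, by omega⟩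
    have := tupleCoeff_succ M v ⟨i, by omega⟩
    simp only at this
    rw [this]
    exact (v ⟨i, by omega⟩).2
  · rw [tupleCoeff, dif_neg h]
    exact zero_mem _

theorem tupleCoeff_zero {ℓ : ℕ} (M : ℕ → Submodule K F) (v : ∀ i : Fin ℓ, M (i + 1)) :
    tupleCoeff M 0 v = 0 := by
  rw [tupleCoeff, dif_neg (by omega)]
  rfl

/-- `shiftCoeff` as a linear map in the tuple. -/
def shiftMap {ℓ : ℕ} (M : ℕ → Submodule K F) (q : ℕ) (a : F) (b : ℕ) :
    (∀ i : Fin ℓ, M (i + 1)) →ₗ[K] F :=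
  ∑ j ∈ Finset.range (ℓ + 1),
    (LinearMap.mulLeft K ((j.choose b : F) * a ^ (q * (j - b)))).comp (tupleCoeff M j)

theorem shiftMap_apply {ℓ : ℕ} (M : ℕ → Submodule K F) (q : ℕ) (a : F) (b : ℕ)
    (v : ∀ i : Fin ℓ, M (i + 1)) :
    shiftMap M q a b v = shiftCoeff q ℓ (fun j => tupleCoeff M j v) a b := by
  simp [shiftMap, shiftCoeff, mul_assoc]

variable [Algebra (RatFunc K) F] [IsScalarTower K (RatFunc K) F] [FunctionField K F]

/-- The count at an error position: the conditions are imposed on the translated coefficients,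
including the one for `b = 0`. -/
theorem exists_submodule_shiftCoeff_mem {P : Place K F} (hP : P.IsRational) {ℓ : ℕ}
    (M : ℕ → Submodule K F) [∀ j, Module.Finite K (M j)] (hM : ∀ j, ∀ g ∈ M j, g ∈ P.ball 0)
    (q s : ℕ) {a : F} (ha : a ∈ P.ball 0) :
    ∃ W : Submodule K (∀ i : Fin ℓ, M (i + 1)),
      Module.finrank K (∀ i : Fin ℓ, M (i + 1)) ≤
        Module.finrank K W + ∑ b ∈ Finset.range s, q * (s - b) ∧
      ∀ v ∈ W, ∀ b, shiftCoeff q ℓ (fun j => tupleCoeff M j v) a b ∈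
        P.ball ((q * (s - b) : ℕ) : ℤ) := by
  have h0 : ∀ b (v : ∀ i : Fin ℓ, M (i + 1)),
      shiftCoeff q ℓ (fun j => tupleCoeff M j v) a b ∈ P.ball 0 := fun b v =>
    shiftCoeff_mem_ball_zero P ha (fun j => hM j _ (tupleCoeff_mem M j v)) b
  refine ⟨⨅ b ∈ Finset.range s, (P.ball ((q * (s - b) : ℕ) : ℤ)).comap (shiftMap M q a b),
    finrank_le_finrank_biInf_add _ _ _ fun b _ =>
      Place.finrank_le_finrank_comap_ball_add hP _ (fun v => ?_) _, fun v hv b => ?_⟩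
  · rw [shiftMap_apply]
    exact h0 b v
  · simp only [Submodule.mem_iInf, Submodule.mem_comap, shiftMap_apply] at hv
    rcases lt_or_ge b s with hbs | hbs
    · exact hv b (Finset.mem_range.2 hbs)
    · rw [Nat.sub_eq_zero_of_le hbs]
      exact h0 b v

/-- The count at an error-free position: as `a` vanishes at `P`, the conditions may be put on the
untranslated `v_j`. The one for `j = 0` is free because `v_0 = 0`, which saves `q * s`. -/
theorem exists_submodule_shiftCoeff_mem_of_mem_ball_one {P : Place K F} (hP : P.IsRational) {ℓ : ℕ}
    (M : ℕ → Submodule K F) [∀ j, Module.Finite K (M j)] (hM : ∀ j, ∀ g ∈ M j, g ∈ P.ball 0)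
    (q s : ℕ) {a : F} (ha : a ∈ P.ball 1) :
    ∃ W : Submodule K (∀ i : Fin ℓ, M (i + 1)),
      Module.finrank K (∀ i : Fin ℓ, M (i + 1)) ≤
        Module.finrank K W + ∑ b ∈ Finset.Ico 1 s, q * (s - b) ∧
      ∀ v ∈ W, ∀ b, shiftCoeff q ℓ (fun j => tupleCoeff M j v) a b ∈
        P.ball ((q * (s - b) : ℕ) : ℤ) := by
  refine ⟨⨅ j ∈ Finset.Ico 1 s, (P.ball ((q * (s - j) : ℕ) : ℤ)).comap (tupleCoeff M j),
    finrank_le_finrank_biInf_add _ _ _ fun j _ =>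
      Place.finrank_le_finrank_comap_ball_add hP _ (fun v => hM j _ (tupleCoeff_mem M j v)) _,
    fun v hv b => shiftCoeff_mem_ball P ha (fun j _ => ?_) b⟩
  simp only [Submodule.mem_iInf, Submodule.mem_comap] at hv
  rcases Nat.eq_zero_or_pos j with rfl | hj
  · rw [tupleCoeff_zero]
    exact zero_mem _
  rcases lt_or_ge j s with hjs | hjs
  · exact hv j (Finset.mem_Ico.2 ⟨hj, hjs⟩)
  · rw [Nat.sub_eq_zero_of_le hjs]
    exact hM j _ (tupleCoeff_mem M j v)

/-- If some codeword is close to the received word `r`, and the dimension count is favourable,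
then there is an interpolation polynomial for `r`. -/
theorem exists_isInterpolation [DecidableEq K] (p : ℕ) [Fact p.Prime] [CharP K p]
    (P : Fin n → Place K F) (hrat : ∀ i, (P i).IsRational)
    {G A : Divisor K F} (hG : SupportDisjoint P G) (hA : SupportDisjoint P A)
    (s ℓ e τ : ℕ) (hs : 1 ≤ s)
    (hcount : (n : ℤ) * (p ^ e * (s * (s - 1))) + 2 * (τ * (p ^ e * s)) <
      ℓ * (2 * (A.deg + 1 - genus K F)) - p ^ e * (ℓ * (ℓ + 1)) * G.deg)
    (r : Fin n → K) {f : F} (hf : f ∈ G.L) (hd : hammingDist r (ev P f) ≤ τ) :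
    ∃ Q : F[X], IsInterpolation P G A p s ℓ e r Q := by
  classical
  have : CharP F p := charP_of_injective_algebraMap (algebraMap K F).injective p
  set q := p ^ e with hq
  have hq0 : 0 < q := pow_pos (Fact.out : p.Prime).pos _
  let M : ℕ → Submodule K F := fun j => (A - (q * j) • G).L
  let V := ∀ i : Fin ℓ, M (i + 1)
  have hfball : ∀ i, f ∈ (P i).ball 0 := fun i => by
    simpa [hG i] using Divisor.mem_L.1 hf (P i)
  have hMball : ∀ i j, ∀ g ∈ M j, g ∈ (P i).ball 0 := fun i j g hg => by
    simpa [hG i, hA i] using Divisor.mem_L.1 hg (P i)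
  let a : Fin n → F := fun i => algebraMap K F (r i) - f
  have ha : ∀ i, a i ∈ (P i).ball 0 := fun i => sub_mem ((P i).algebraMap_mem_ball _) (hfball i)
  have ha1 : ∀ i, r i = ev P f i → a i ∈ (P i).ball 1 := by
    intro i hi
    have := Place.sub_eval_mem_ball_one (hrat i) (hfball i)
    rw [← neg_mem_iff, neg_sub] at this
    change algebraMap K F (r i) - f ∈ _
    rw [hi]
    exact this
  let κ₀ : ℕ := ∑ j ∈ Finset.Ico 1 s, q * (s - j)
  have hκ₁ : ∑ b ∈ Finset.range s, q * (s - b) = q * s + κ₀ := by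
    rw [Finset.range_eq_Ico, Finset.sum_eq_sum_Ico_succ_bot (by omega)]
    rfl
  have hκ₂ : (2 * κ₀ : ℤ) = q * (s * (s - 1)) := by
    have h2 : ∀ s : ℕ, (2 * ∑ b ∈ Finset.range s, (q * (s - b) : ℕ) : ℤ) = q * (s * (s + 1)) := by
      intro s
      induction s with
      | zero => simp
      | succ s ih =>
        rw [Finset.sum_range_succ']
        simp only [Nat.add_sub_add_right, Nat.sub_zero]
        push_cast at ih ⊢
        linarith
    have h3 := h2 s
    rw [hκ₁] at h3
    push_cast at h3
    linarith
  -- Every position costs `κ₀ = q s (s - 1) / 2`, and each error costs `q s` more.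
  let κ : Fin n → ℕ := fun i => κ₀ + if r i ≠ ev P f i then q * s else 0
  have hWex : ∀ i, ∃ W : Submodule K V, Module.finrank K V ≤ Module.finrank K W + κ i ∧
      ∀ v ∈ W, ∀ b, shiftCoeff q ℓ (fun j => tupleCoeff M j v) (a i) b ∈
        (P i).ball ((q * (s - b) : ℕ) : ℤ) := by
    intro i
    by_cases hi : r i = ev P f i
    · have hκi : κ i = κ₀ := by simp [κ, hi]
      rw [hκi]
      exact exists_submodule_shiftCoeff_mem_of_mem_ball_one (hrat i) M (hMball i) q s (ha1 i hi)
    · have hκi : κ i = ∑ b ∈ Finset.range s, q * (s - b) := by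
        rw [hκ₁, add_comm]
        simp [κ, hi]
      rw [hκi]
      exact exists_submodule_shiftCoeff_mem (hrat i) M (hMball i) q s (ha i)
  choose W hW hWshift using hWex
  have htotal : (∑ i, κ i : ℕ) = n * κ₀ + hammingDist r (ev P f) * (q * s) := by
    simp only [κ, Finset.sum_add_distrib, Finset.sum_const, Finset.card_univ, Fintype.card_fin,
      smul_eq_mul, ← Finset.sum_filter]
    rfl
  have hdimV : ℓ * (2 * (A.deg + 1 - genus K F)) - q * (ℓ * (ℓ + 1)) * G.deg ≤
      2 * (Module.finrank K V : ℤ) := by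
    have h1 : Module.finrank K V = ∑ i : Fin ℓ, (A - (q * (i + 1)) • G).dim :=
      Module.finrank_pi_fintype K
    have h2 : ∀ i : Fin ℓ, A.deg + 1 - genus K F - q * ((i : ℕ) + 1) * G.deg ≤
        ((A - (q * (i + 1)) • G).dim : ℤ) := by
      intro i
      have := Divisor.riemann_inequality (A - (q * ((i : ℕ) + 1)) • G)
      rw [Divisor.deg_sub, Divisor.deg_nsmul] at this
      push_cast at this
      linarith
    have h3 : ∀ m : ℕ, 2 * ∑ i : Fin m, (A.deg + 1 - genus K F - q * ((i : ℕ) + 1) * G.deg) =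
        m * (2 * (A.deg + 1 - genus K F)) - q * (m * (m + 1)) * G.deg := by
      intro m
      induction m with
      | zero => simp
      | succ m ih =>
        rw [Fin.sum_univ_castSucc]
        simp only [Fin.val_castSucc, Fin.val_last]
        push_cast
        linarith
    rw [h1, ← h3 ℓ]
    push_cast
    exact mul_le_mul_of_nonneg_left (Finset.sum_le_sum fun i _ => h2 i) (by norm_num)
  have hpos : 0 < Module.finrank K (⨅ i ∈ Finset.univ, W i : Submodule K V) := by
    have h1 := finrank_le_finrank_biInf_add Finset.univ W κ fun i _ => hW i
    rw [htotal] at h1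
    zify at h1 ⊢
    have h2 : (hammingDist r (ev P f) : ℤ) * (q * s) ≤ τ * (q * s) :=
      mul_le_mul_of_nonneg_right (by exact_mod_cast hd) (by positivity)
    have h3 : (2 : ℤ) * (n * κ₀) = n * (q * (s * (s - 1))) := by rw [← hκ₂]; ring
    have hq' : (q : ℤ) = (p : ℤ) ^ e := by rw [hq]; push_cast; rfl
    rw [← hq'] at hcount
    linarith
  obtain ⟨v, hv, hv0⟩ := Submodule.exists_mem_ne_zero_of_ne_bot
    (p := ⨅ i ∈ Finset.univ, W i) fun h => by
      rw [h, finrank_bot] at hpos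
      exact lt_irrefl _ hpos
  let w : ℕ → F := fun j => tupleCoeff M j v
  have hshift : ∀ i b, shiftCoeff q ℓ w (a i) b ∈ (P i).ball ((q * (s - b) : ℕ) : ℤ) := by
    intro i b
    have hvi : v ∈ W i := by
      simp only [Submodule.mem_iInf] at hv
      exact hv i (Finset.mem_univ i)
    exact hWshift i v hvi b
  have hne : insepPoly q ℓ w ≠ 0 := by
    obtain ⟨i, hi⟩ := Function.ne_iff.1 hv0
    intro h0
    have h1 := coeff_insepPoly_mul hq0 w (show (i : ℕ) + 1 ≤ ℓ by omega)
    rw [h0, coeff_zero] at h1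
    exact hi (Subtype.ext (by rw [← tupleCoeff_succ M v i]; exact h1.symm))
  -- Here `Q(z) = R(z - f)`, so translating `Q` by `r_i` is translating `R` by `a_i = r_i - f`.
  refine ⟨taylor (-f) (insepPoly q ℓ w), ?_, ⟨shiftCoeff q ℓ w (-f), fun j _ => ?_, ?_⟩,
    fun i => ?_⟩
  · exact fun h => hne (taylor_injective (-f) (by rw [h, map_zero]))
  · exact shiftCoeff_mem_L (neg_mem hf) (fun j => tupleCoeff_mem M j v) j
  · exact taylor_insepPoly p e ℓ w (-f)
  · refine Place.hasZeroOfMultAtLeast_of_coeff_mem (hrat i) fun b => ?_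
    rw [taylor_taylor, show algebraMap K F (r i) + -f = a i from (sub_eq_add_neg _ _).symm]
    rw [hq, taylor_insepPoly p e ℓ w, ← hq]
    by_cases hb : ∃ c ≤ ℓ, b = q * c
    · obtain ⟨c, hc, rfl⟩ := hb
      rw [coeff_insepPoly_mul hq0 _ hc, ← Nat.mul_sub]
      exact hshift i c
    · push Not at hb
      rw [coeff_insepPoly_eq_zero _ hb]
      exact zero_mem _

/-- An interpolation polynomial vanishes at all functions whose codeword is close to the received
word. -/
theorem IsInterpolation.eval_eq_zero [DecidableEq K] {p s ℓ e τ : ℕ}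
    {P : Fin n → Place K F} (hP : Function.Injective P) (hrat : ∀ i, (P i).IsRational)
    {G A : Divisor K F} (hG : SupportDisjoint P G) (hA : SupportDisjoint P A)
    (hdeg : A.deg < (p : ℤ) ^ e * s * ((n : ℤ) - τ))
    {r : Fin n → K} {Q : F[X]} (hQ : IsInterpolation P G A p s ℓ e r Q) {f : F} (hf : f ∈ G.L)
    (hd : hammingDist r (ev P f) ≤ τ) : Q.eval f = 0 := by
  classical
  obtain ⟨-, ⟨c, hc, hQc⟩, hzero⟩ := hQ
  by_contra hne
  have hL : Q.eval f ∈ A.L := by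
    rw [hQc, eval_finsetSum]
    refine sum_mem fun j hj => ?_
    have h1 := Divisor.mul_mem_L (hc j (Nat.lt_succ_iff.1 (Finset.mem_range.1 hj)))
      (Divisor.pow_mem_L hf (p ^ e * j))
    rw [sub_add_cancel] at h1
    simpa using h1
  let T : Finset (Fin n) := Finset.univ.filter fun i => ¬ r i ≠ ev P f i
  -- The zeros forced on `Q(f)` by the agreement positions `T`; then `L(A - E)` has negative degree.
  let E : Divisor K F := ∑ i ∈ T, Finsupp.single (P i) ((p ^ e * s : ℕ) : ℤ)
  have hEdeg : E.deg = T.card * ((p ^ e * s : ℕ) : ℤ) := by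
    have : ∀ T : Finset (Fin n), Divisor.deg (∑ i ∈ T, Finsupp.single (P i)
        ((p ^ e * s : ℕ) : ℤ) : Divisor K F) = T.card * ((p ^ e * s : ℕ) : ℤ) := by
      intro T
      induction T using Finset.induction_on with
      | empty => simp [Divisor.deg_zero]
      | insert i T hi ih =>
        rw [Finset.sum_insert hi, Divisor.deg_add, ih, Divisor.deg_single,
          show (P i).degree = 1 from hrat i, Finset.card_insert_of_notMem hi]
        push_cast
        ring
    exact this T
  have hLE : Q.eval f ∈ (A - E).L := by
    rw [Divisor.mem_L]
    intro R
    by_cases hR : ∃ i ∈ T, P i = R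
    · obtain ⟨i, hi, rfl⟩ := hR
      have hEi : E (P i) = ((p ^ e * s : ℕ) : ℤ) := by
        simp only [E, Finsupp.finsetSum_apply]
        rw [Finset.sum_eq_single_of_mem i hi fun j _ hj => by
          rw [Finsupp.single_apply, if_neg fun h => hj (hP h)]]
        simp
      have hfb : f ∈ (P i).ball 0 := by simpa [hG i] using Divisor.mem_L.1 hf (P i)
      have hri : r i = (P i).eval f := not_not.1 (Finset.mem_filter.1 hi).2
      have h1 := (hzero i).eval_mem_ball (f := f) (by
        rw [hri]
        exact Place.sub_eval_mem_ball_one (hrat i) hfb)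
      rwa [Finsupp.sub_apply, hEi, hA i, zero_sub, neg_neg]
    · have hER : E R = 0 := by
        simp only [E, Finsupp.finsetSum_apply]
        refine Finset.sum_eq_zero fun i hi => ?_
        rw [Finsupp.single_apply, if_neg fun h => hR ⟨i, hi, h⟩]
      rw [Finsupp.sub_apply, hER, sub_zero]
      exact Divisor.mem_L.1 hL R
  have h0 := Divisor.deg_nonneg_of_mem_L hLE hne
  rw [Divisor.deg_sub, hEdeg] at h0
  have hcard : hammingDist r (ev P f) + T.card = n := by
    have := Finset.card_filter_add_card_filter_not (s := (Finset.univ : Finset (Fin n)))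
      fun i => r i ≠ ev P f i
    rwa [Finset.card_univ, Fintype.card_fin] at this
  have h1 : (p : ℤ) ^ e * s * ((n : ℤ) - τ) ≤ T.card * ((p ^ e * s : ℕ) : ℤ) := by
    push_cast
    rw [mul_comm]
    refine mul_le_mul_of_nonneg_right ?_ (by positivity)
    omega
  linarith

end Interpolation

/-! ### The list-decoding radius. -/

theorem insepGSHasRadiusAtLeast {K F : Type*} [Field K] [DecidableEq K] [Field F] [Algebra K F]
    [Algebra (RatFunc K) F] [IsScalarTower K (RatFunc K) F] [FunctionField K F]
    (p : ℕ) [Fact p.Prime] [CharP K p] {n : ℕ} (hn : 0 < n)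
    {P : Fin n → Place K F} (hP : Function.Injective P) (hrat : ∀ i, (P i).IsRational)
    {G : Divisor K F} (hG : SupportDisjoint P G) {s ℓ : ℕ} (hs : 1 ≤ s) (e : ℕ) :
    InsepGSHasRadiusAtLeast P G p s ℓ e
      (((s : ℝ) * (2 * ℓ - s + 1) * n - ℓ * (ℓ + 1) * (G.deg : ℝ)) / (2 * s * (ℓ + 1))
        - (1 + (genus K F : ℝ) * ℓ) / ((p : ℝ) ^ e * s * (ℓ + 1))) := by
  have hp : p.Prime := Fact.out
  have : CharP F p := charP_of_injective_algebraMap (algebraMap K F).injective p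
  intro τ hτ
  refine ⟨Divisor.exists_supportDisjoint_deg_eq hn P (hrat _) _, fun A hA hAdeg Dec hDec r => ?_⟩
  have hcount : (n : ℤ) * (p ^ e * (s * (s - 1))) + 2 * (τ * (p ^ e * s)) <
      ℓ * (2 * (A.deg + 1 - genus K F)) - p ^ e * (ℓ * (ℓ + 1)) * G.deg := by
    have hq : (0 : ℝ) < (p : ℝ) ^ e := pow_pos (by exact_mod_cast hp.pos) _
    have hs' : (0 : ℝ) < s := by exact_mod_cast hs
    -- The `1` in `1 + g ℓ` leaves a surplus of `2` after clearing denominators, which makes the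
    -- dimension count strict.
    have h1 : (τ : ℝ) * (2 * (p ^ e * s * (ℓ + 1))) ≤
        p ^ e * (s * (2 * ℓ - s + 1) * n - ℓ * (ℓ + 1) * G.deg) - 2 * (1 + genus K F * ℓ) := by
      have h2 := mul_le_mul_of_nonneg_right hτ
        (show (0 : ℝ) ≤ 2 * (p ^ e * s * (ℓ + 1)) by positivity)
      refine h2.trans (le_of_eq ?_)
      field_simp
    rw [hAdeg]
    have h3 : (((n : ℤ) * (p ^ e * (s * (s - 1))) + 2 * (τ * (p ^ e * s)) : ℤ) : ℝ) <
        ((ℓ * (2 * ((p : ℤ) ^ e * s * ((n : ℤ) - τ) - 1 + 1 - genus K F)) -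
          p ^ e * (ℓ * (ℓ + 1)) * G.deg : ℤ) : ℝ) := by
      push_cast
      linarith
    exact_mod_cast h3
  rcases hDec r with ⟨Q, hQ, hD⟩ | ⟨hno, hD⟩
  · rw [hD]
    refine ⟨Set.image_mono fun f hf => hf.1, ?_, ?_⟩
    · obtain ⟨hQ0, ⟨c, -, hQc⟩, -⟩ := hQ
      have hQc' : Q = insepPoly (p ^ e) ℓ c := hQc
      refine (Set.encard_image_le _ _).trans ((Set.encard_le_encard fun f hf => hf.2).trans ?_)
      rw [hQc'] at hQ0 ⊢
      exact encard_roots_insepPoly_le p e ℓ c hQ0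
    · rintro _ ⟨f, hf, rfl⟩ hd
      exact ⟨f, ⟨hf, hQ.eval_eq_zero hP hrat hG hA (by rw [hAdeg]; omega) hf hd⟩, rfl⟩
  · rw [hD]
    refine ⟨Set.empty_subset _, by simp, ?_⟩
    rintro _ ⟨f, hf, rfl⟩ hd
    -- A codeword within distance `τ` would produce an interpolation polynomial, so the empty list
    -- misses nothing.
    exact absurd (exists_isInterpolation p P hrat hG hA s ℓ e τ hs hcount r hf hd) hno

theorem InsepGSHasRadiusAtLeast.mono {K F : Type*} [Field K] [DecidableEq K] [Field F]
    [Algebra K F] {n : ℕ} {P : Fin n → Place K F} {G : Divisor K F} {p s ℓ e : ℕ} {ρ ρ' : ℝ}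
    (h : InsepGSHasRadiusAtLeast P G p s ℓ e ρ) (hρ : ρ' ≤ ρ) :
    InsepGSHasRadiusAtLeast P G p s ℓ e ρ' := fun τ hτ => h τ (hτ.trans hρ)

end AGCode

end

theorem corollary3p2 {K F : Type*} [Field K] [Finite K] [DecidableEq K] [Field F] [Algebra K F]
    [Algebra (RatFunc K) F] [IsScalarTower K (RatFunc K) F] [FunctionField K F]
    (p : ℕ) [CharP K p] {n : ℕ} (hn : 0 < n)
    (P : Fin n → AGCode.Place K F) (hP : Function.Injective P) (hrat : ∀ i, (P i).IsRational)
    (G : AGCode.Divisor K F) (hG : AGCode.SupportDisjoint P G)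
    (s ℓ : ℕ) (hs : 1 ≤ s) (hsl : s ≤ ℓ) :
    (∀ e : ℕ, AGCode.InsepGSHasRadiusAtLeast P G p s ℓ e
      (((s : ℝ) * (2 * ℓ - s + 1) * n - ℓ * (ℓ + 1) * (G.deg : ℝ)) / (2 * s * (ℓ + 1))
        - (1 + (AGCode.genus K F : ℝ) * ℓ) / ((p : ℝ) ^ e * s * (ℓ + 1)))) ∧
    AGCode.InsepGSHasRadiusAtLeast P G p s ℓ
      ⌈Real.logb p (1 + (AGCode.genus K F : ℝ) * ℓ)⌉₊
      (((s : ℝ) * (2 * ℓ - s + 1) * n - ℓ * (ℓ + 1) * (G.deg : ℝ) - 2) / (2 * s * (ℓ + 1))) := by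
  have hp : p.Prime := CharP.char_is_prime K p
  have : Fact p.Prime := ⟨hp⟩
  refine ⟨AGCode.insepGSHasRadiusAtLeast p hn hP hrat hG hs, ?_⟩
  refine (AGCode.insepGSHasRadiusAtLeast p hn hP hrat hG hs _).mono ?_
  set N : ℝ := 1 + (AGCode.genus K F : ℝ) * ℓ
  have hN : 0 < N := by positivity
  have hp1 : (1 : ℝ) < p := by exact_mod_cast hp.one_lt
  have hs' : (0 : ℝ) < s := by exact_mod_cast hs
  -- Once `p ^ e ≥ 1 + g ℓ`, the correction term is at most `1 / (s (ℓ + 1))`.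
  have hpow : N ≤ (p : ℝ) ^ ⌈Real.logb p N⌉₊ := by
    rw [← Real.rpow_natCast, ← Real.logb_le_iff_le_rpow hp1 hN]
    exact Nat.le_ceil _
  have hpos : (0 : ℝ) < (p : ℝ) ^ ⌈Real.logb p N⌉₊ := by positivity
  have h1 : N / ((p : ℝ) ^ ⌈Real.logb p N⌉₊ * s * (ℓ + 1)) ≤ 2 / (2 * s * (ℓ + 1)) := by
    rw [div_le_div_iff₀ (by positivity) (by positivity)]
    have : 0 ≤ (s : ℝ) * (ℓ + 1) := by positivity
    nlinarith
  rw [sub_div]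
  linarith
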